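/- **Generalized Thorpe Inequalities.** Let $k\ge 1$, let $(M,g)$ be a smooth oriented Riemannian manifold of dimension $4k$ (without boundary), and let $\xi\to M$ be a smooth oriented real vector bundle of rank $4k$ with a smooth inner product $h$ and a smooth connection $D$ compatible with $h$. Let $$R(X,Y)s=D_XD_Ys-D_YD_Xs-D_{[X,Y]}s$$ be its curvature. *Notation.* At a point $x\in M$ choose oriented orthonormal bases $e_1,\dots,e_{4k}$ of $T_xM$ and $s_1,\dots,s_{4k}$ of $\xi_x$, with dual bases $e^i$, $s^a$; put $\epsilon=e^1\wedge\dots\wedge e^{4k}$. - The curvature matrix of $2$-forms is $R^a{}_b(X,Y)=s^a(R(X,Y)s_b)$. The $k$-th Pontryagin form and the Euler form of $(\xi,h,D)$ are the Chern–Weil forms in $\Lambda^{4k}T_x^*M$ $$p_k(\xi)=\frac1{(2\pi)^{2k}}\sum_{1\le a_1<\dots<a_{2k}\le 4k}\ \sum_{\sigma\in S_{2k}}(-1)^\sigma R^{a_1}{}_{a_{\sigma(1)}}\wedge\dots\wedge R^{a_{2k}}{}_{a_{\sigma(2k)}},$$ $$e(\xi)=\frac1{(2\pi)^{2k}2^{2k}(2k)!}\sum_{\sigma\in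 S_{4k}}(-1)^\sigma R^{\sigma(1)}{}_{\sigma(2)}\wedge\dots\wedge R^{\sigma(4k-1)}{}_{\sigma(4k)}.$$ - $R$ is also regarded as the bi-form $R=\sum_{i<j}\sum_{a<b}h(R(e_i,e_j)s_b,s_a)\,(e^i\wedge e^j)\otimes(s^a\wedge s^b)\in\Lambda^2T_x^*M\otimes\Lambda^2\xi_x^*$, and $R^k\in\Lambda^{2k}T_x^*M\otimes\Lambda^{2k}\xi_x^*$ is its $k$-th power for the product $(\phi_1\otimes\psi_1)\wedge(\phi_2\otimes\psi_2)=(\phi_1\wedge\phi_2)\otimes(\psi_1\wedge\psi_2)$. - $(R^k)^{\pm}_{\pm}$ (superscript for the factor $T^*M$, subscript for the factor $\xi^*$) are the four components of $R^k$ in the decomposition induced by $\Lambda^{2k}=\Lambda^{2k}_+\oplus\Lambda^{2k}_-$ into the $\pm1$-eigenspaces of the Hodge star on each factor, and $|\cdot|$ is the norm in which the elements $e^I\otimes s^J$ ($I$, $J$ increasing multi-indices) are orthonormal. - Inequalities between elements of $\Lambda^{4k}T_x^*M$, and absolute values there, refer to this real line as oriented by $\epsilon$. *Claim.* At every point of $M$: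 $$\binom{2k}{k}e(\xi)+p_k(\xi)=\frac{2}{(2\pi)^{2k}(k!)^2}\left(|(R^k)^+_+|^2-|(R^k)^-_+|^2\right)\epsilon,$$ $$\binom{2k}{k}e(\xi)-p_k(\xi)=\frac{2}{(2\pi)^{2k}(k!)^2}\left(|(R^k)^-_-|^2-|(R^k)^+_-|^2\right)\epsilon.$$ Thus, if $(R^k)^-_+=0$, then $\binom{2k}{k}e(\xi)+p_k(\xi)\ge 0$; if $(R^k)^+_-=0$, then $\binom{2k}{k}e(\xi)-p_k(\xi)\ge0$; and if both vanish, then $\binom{2k}{k}e(\xi)\ge|p_k(\xi)|$. When $\xi=TM$, $h=g$ and $D$ is the Levi-Civita connection of $g$, one has $(R^k)^-_+=0$ if and only if $(R^k)^+_-=0$; hence either condition gives $\binom{2k}{k}e(TM)\ge|p_k(TM)|$. -/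

import Mathlib

open scoped Manifold ContDiff TensorProduct Topology
open Module Bundle

namespace Thorpe

noncomputable section

section LinearAlgebra

variable {T : Type*} [NormedAddCommGroup T] [InnerProductSpace ℝ T]
  {W : Type*} [NormedAddCommGroup W] [InnerProductSpace ℝ W] {n m : ℕ}

/-- The algebra `Λ T* = ⨁ₚ Λᵖ T*` of alternating forms on `T`; its product is the wedge product. -/
abbrev Forms (T : Type*) [AddCommGroup T] [Module ℝ T] : Type _ :=
  ExteriorAlgebra ℝ (Dual ℝ T)

/-- The algebra `Λ T* ⊗ Λ W*` of bi-forms. Its product is Mathlib's product on a tensor product of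
algebras, `(φ₁ ⊗ ψ₁) * (φ₂ ⊗ ψ₂) = (φ₁ ∧ φ₂) ⊗ (ψ₁ ∧ ψ₂)`, so `R ^ p` is `R ∧ ⋯ ∧ R`. -/
abbrev BiForms (T W : Type*) [AddCommGroup T] [Module ℝ T] [AddCommGroup W] [Module ℝ W] : Type _ :=
  Forms T ⊗[ℝ] Forms W

/-- The one-form `eⁱ` of the coframe dual to `e`. -/
def coframe (e : OrthonormalBasis (Fin n) ℝ T) (i : Fin n) : Forms T :=
  ExteriorAlgebra.ι ℝ (e.toBasis.coord i)

/-- The basis `e^I = e^{i₁} ∧ ⋯ ∧ e^{iₚ}`, `I = {i₁ < ⋯ < iₚ}`, of `Λ T*`. -/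
def formBasis (e : OrthonormalBasis (Fin n) ℝ T) : Basis (Finset (Fin n)) ℝ (Forms T) :=
  e.toBasis.dualBasis.ExteriorAlgebra

/-- `e¹ ∧ ⋯ ∧ eⁿ`, the volume element of the orientation that `e` induces. -/
def volumeElement (e : OrthonormalBasis (Fin n) ℝ T) : Forms T :=
  formBasis e Finset.univ

/-- The star operator `Λᵖ T* → Λⁿ⁻ᵖ T*`, for all `p` at once, of the inner product of `T` and of the
orientation that `e` induces. It is determined by `e^I ∧ *e^I = e¹ ∧ ⋯ ∧ eⁿ`: with `c` the
coefficient of `e¹ ∧ ⋯ ∧ eⁿ` in `e^I ∧ e^{Iᶜ}` (which is `1` or `-1`), `*e^I = c e^{Iᶜ}`. -/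
def hodgeStar (e : OrthonormalBasis (Fin n) ℝ T) : Forms T →ₗ[ℝ] Forms T :=
  (formBasis e).constr ℝ fun I =>
    (formBasis e).repr (formBasis e I * formBasis e Iᶜ) Finset.univ • formBasis e Iᶜ

/-- `½ (1 + ε *)` for a sign `ε`. If `n = 4 k`, this is on `Λ²ᵏ T*` the orthogonal projection to
the self-dual (`ε = 1`) or anti-self-dual (`ε = -1`) forms. -/
def dualProj (e : OrthonormalBasis (Fin n) ℝ T) (ε : ℤˣ) : Forms T →ₗ[ℝ] Forms T :=
  (1 / 2 : ℝ) • (LinearMap.id + ((ε : ℤ) : ℝ) • hodgeStar e)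

/-- The component `B^ε_δ` of a bi-form `B ∈ Λ²ᵏ T* ⊗ Λ²ᵏ W*` in `Λ²ᵏ_ε T* ⊗ Λ²ᵏ_δ W*`: the first
sign (the superscript) belongs to `T`, the second (the subscript) to `W`. -/
def component (e : OrthonormalBasis (Fin n) ℝ T) (s : OrthonormalBasis (Fin m) ℝ W) (ε δ : ℤˣ)
    (B : BiForms T W) : BiForms T W :=
  TensorProduct.map (dualProj e ε) (dualProj s δ) B

/-- The square `|B|²` of the norm for which the bi-forms `e^I ⊗ s^J` are orthonormal. -/
def normSq (e : OrthonormalBasis (Fin n) ℝ T) (s : OrthonormalBasis (Fin m) ℝ W)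
    (B : BiForms T W) : ℝ :=
  ∑ p : Finset (Fin n) × Finset (Fin m),
    (((formBasis e).tensorProduct (formBasis s)).repr B p) ^ 2

/-- The `(2, 2)`-bi-form `R = ∑_{i<j} ∑_{a<b} ⟨R(eᵢ, eⱼ) s_b, s_a⟩ (eⁱ ∧ eʲ) ⊗ (sᵃ ∧ sᵇ)` of an
operator `R` that is bilinear and skew in its first two arguments and has skew-adjoint values. -/
def curvatureBiForm (R : T → T → W → W) (e : OrthonormalBasis (Fin n) ℝ T)
    (s : OrthonormalBasis (Fin m) ℝ W) : BiForms T W :=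
  (1 / 4 : ℝ) • ∑ i, ∑ j, ∑ a, ∑ b, (inner ℝ (R (e i) (e j) (s b)) (s a) : ℝ) •
    ((coframe e i * coframe e j) ⊗ₜ[ℝ] (coframe s a * coframe s b))

/-- The component `(Rᵏ)^ε_δ` of the `k`-th wedge power of the curvature bi-form. -/
def powComponent (k : ℕ) (R : T → T → W → W) (e : OrthonormalBasis (Fin n) ℝ T)
    (s : OrthonormalBasis (Fin m) ℝ W) (ε δ : ℤˣ) : BiForms T W :=
  component e s ε δ (curvatureBiForm R e s ^ k)

/-- The matrix of two-forms `R^a_b = ∑_{i<j} s^a(R(eᵢ, eⱼ) s_b) eⁱ ∧ eʲ` of an operator `R` that is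
bilinear and skew in its first two arguments. -/
def curvatureMatrix (R : T → T → W → W) (e : OrthonormalBasis (Fin n) ℝ T)
    (s : OrthonormalBasis (Fin m) ℝ W) : Matrix (Fin m) (Fin m) (Forms T) :=
  fun a b => (1 / 2 : ℝ) •
    ∑ i, ∑ j, s.toBasis.coord a (R (e i) (e j) (s b)) • (coframe e i * coframe e j)

/-- The Chern–Weil expression for the `k`-th Pontryagin form in terms of the curvature matrix `Ω` of
`R`:
`(2π)^{-2k} ∑_{a₁ < ⋯ < a₂ₖ} ∑_σ (-1)^σ Ω^{a₁}_{a_{σ(1)}} ∧ ⋯ ∧ Ω^{a₂ₖ}_{a_{σ(2k)}}`. -/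
def pontryaginForm (k : ℕ) (R : T → T → W → W) (e : OrthonormalBasis (Fin n) ℝ T)
    (s : OrthonormalBasis (Fin m) ℝ W) : Forms T :=
  let Ω := curvatureMatrix R e s
  (1 / (2 * Real.pi) ^ (2 * k) : ℝ) •
    ∑ A : Set.powersetCard (Fin m) (2 * k), ∑ σ : Equiv.Perm (Fin (2 * k)),
      ((Equiv.Perm.sign σ : ℤ) : ℝ) •
        (List.ofFn fun i => Ω (Set.powersetCard.ofFinEmbEquiv.symm A i)
          (Set.powersetCard.ofFinEmbEquiv.symm A (σ i))).prod

/-- The Chern–Weil (Pfaffian) expression for the Euler form in terms of the curvature matrix `Ω`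
of `R` in an oriented orthonormal frame of a bundle of rank `4 k`:
`((2π)^{2k} 2^{2k} (2k)!)⁻¹ ∑_σ (-1)^σ Ω^{σ(1)}_{σ(2)} ∧ ⋯ ∧ Ω^{σ(4k-1)}_{σ(4k)}`. -/
def eulerForm (k : ℕ) (R : T → T → W → W) (e : OrthonormalBasis (Fin n) ℝ T)
    (s : OrthonormalBasis (Fin (4 * k)) ℝ W) : Forms T :=
  let Ω := curvatureMatrix R e s
  (1 / ((2 * Real.pi) ^ (2 * k) * 2 ^ (2 * k) * (2 * k).factorial) : ℝ) •
    ∑ σ : Equiv.Perm (Fin (4 * k)), ((Equiv.Perm.sign σ : ℤ) : ℝ) •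
      (List.ofFn fun i : Fin (2 * k) =>
        Ω (σ ⟨2 * i, by omega⟩) (σ ⟨2 * i + 1, by omega⟩)).prod

/-- `0 ≤ α` for a top-degree form `α`, in the real line oriented by the volume element `v`. -/
def TopNonneg (v α : Forms T) : Prop :=
  ∃ c : ℝ, 0 ≤ c ∧ α = c • v

/-- `|α| ≤ β` for top-degree forms, in the real line oriented by the volume element `v`. -/
def TopAbsLE (v α β : Forms T) : Prop :=
  ∃ a b : ℝ, α = a • v ∧ β = b • v ∧ |a| ≤ b

end LinearAlgebra

section Bundles

variable {E : Type*} [NormedAddCommGroup E] [NormedSpace ℝ E]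
  {M : Type*} [TopologicalSpace M] [ChartedSpace E M]
  {F : Type*} [NormedAddCommGroup F] [NormedSpace ℝ F]
  {V : M → Type*} [TopologicalSpace (TotalSpace F V)]
  [∀ x, AddCommGroup (V x)] [∀ x, Module ℝ (V x)] [∀ x, TopologicalSpace (V x)]
  [FiberBundle F V]

/-- An orientation of a vector bundle of rank `n`: an orientation of every fiber that is locally
constant in the local trivializations. -/
structure BundleOrientation {M : Type*} [TopologicalSpace M]
    (F : Type*) [NormedAddCommGroup F] [NormedSpace ℝ F]
    (V : M → Type*) [TopologicalSpace (TotalSpace F V)]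
    [∀ x, AddCommGroup (V x)] [∀ x, Module ℝ (V x)] [∀ x, TopologicalSpace (V x)]
    [FiberBundle F V] [VectorBundle ℝ F V] (n : ℕ) where
  orientationAt : ∀ x, Orientation ℝ (V x) (Fin n)
  locallyConstant : ∀ x₀, ∃ o₀ : Orientation ℝ F (Fin n), ∀ᶠ x in 𝓝 x₀,
    ∃ hx : x ∈ (trivializationAt F V x₀).baseSet,
      Orientation.map (Fin n)
        ((trivializationAt F V x₀).continuousLinearEquivAt ℝ x hx).toLinearEquiv
        (orientationAt x) = o₀

/-- The curvature `R(X, Y) s = D_X D_Y s - D_Y D_X s - D_{[X,Y]} s` of a connection at a point `x`.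
It is tensorial, so it can be evaluated on vectors `u`, `v`, `w` at `x` by extending them to a
neighbourhood of `x`; `FiberBundle.extend` is the extension that is constant in the preferred local
trivialization at `x`. In Mathlib `D s y u` is `D_u s` at `y`. -/
def curvature [∀ x, IsTopologicalAddGroup (V x)] [∀ x, ContinuousSMul ℝ (V x)]
    [IsManifold 𝓘(ℝ, E) 1 M]
    (D : CovariantDerivative 𝓘(ℝ, E) F V) (x : M)
    (u v : TangentSpace 𝓘(ℝ, E) x) (w : V x) : V x :=
  let X : ∀ y : M, TangentSpace 𝓘(ℝ, E) y := FiberBundle.extend E u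
  let Y : ∀ y : M, TangentSpace 𝓘(ℝ, E) y := FiberBundle.extend E v
  let s : ∀ y : M, V y := FiberBundle.extend F w
  D (fun y => D s y (Y y)) x (X x) - D (fun y => D s y (X y)) x (Y x)
    - D s x (VectorField.mlieBracket 𝓘(ℝ, E) X Y x)

end Bundles

end

end Thorpe

open Thorpe

/-! Let `Ω` be the curvature matrix and expand `R ^ k = ∑_J q_J ⊗ s^J`. Since `R = ½ ∑ Ω_ab ⊗ (sᵃ ∧
sᵇ)`, the coefficient is `q_J = k! Pf(Ω_J)`, where `Ω_J` is the principal submatrix on `J`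
(`sum_tmul_pow`, `curvatureBiForm_pow`). Both characteristic forms are quadratic in the `q_J`:

The Pontryagin form is a sum of principal minors, and `det Ω_J = Pf(Ω_J)²` (`pfSum_sq`), so up to a
constant it is `∑ q_J ∧ q_J` (`pontryaginForm_eq`).

The Euler form is a multiple of `Pf(Ω)`, the coefficient of the fiber volume element in `R ^ (2k) =
R ^ k * R ^ k`, so up to a constant it is `∑ ± q_J ∧ q_{Jᶜ}` (`eulerForm_eq`).

In middle degree `α ∧ β = ⟨α, *β⟩ ε`. With `B = R ^ k` the two sums are therefore `⟨B, (* ⊗ 1) B⟩`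
and `⟨B, (* ⊗ *) B⟩`. Because `*` is a symmetric involution there, `|B^+_δ|² - |B^-_δ|²` equals `½
(⟨B, (* ⊗ 1) B⟩ + δ ⟨B, (* ⊗ *) B⟩)` (`normSq_component_sub`). This gives both identities, and the
inequalities follow at once.

The only geometric input is the skewness of `Ω`, which comes from differentiating `⟨s, t⟩` twice
(`inner_curvature_skew`). For the Levi-Civita connection the first Bianchi identity
(`curvature_bianchi`) adds symmetry in pairs. Then `R ^ k` is invariant under exchange of the two
tensor factors, which interchanges its mixed components. -/

namespace Thorpe

noncomputable section

/-! ### Powers of degree-two forms and Pfaffian sums -/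

section Expansion

/-- A sum over all maps `Fin q → I` whose terms vanish off the injective maps is a sum over the
increasing sequences and their permutations. -/
lemma sum_eq_sum_powersetCard_perm {I G : Type*} [Fintype I] [LinearOrder I] [AddCommMonoid G]
    {q : ℕ} (Φ : (Fin q → I) → G) (hΦ : ∀ g, ¬ Function.Injective g → Φ g = 0) :
    ∑ g, Φ g = ∑ A : Set.powersetCard I q, ∑ σ : Equiv.Perm (Fin q),
      Φ fun i => Set.powersetCard.ofFinEmbEquiv.symm A (σ i) := by
  classical
  rw [← Fintype.sum_prod_type']
  symm
  refine Fintype.sum_of_injective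
    (fun p : Set.powersetCard I q × Equiv.Perm (Fin q) =>
      fun i => Set.powersetCard.ofFinEmbEquiv.symm p.1 (p.2 i)) ?_ _ _ ?_ fun _ => rfl
  · rintro ⟨A, σ⟩ ⟨B, τ⟩ h
    have hAB : A = B := by
      refine Subtype.ext (Finset.ext fun i => ?_)
      change i ∈ A ↔ i ∈ B
      rw [← Set.powersetCard.mem_range_ofFinEmbEquiv_symm_iff_mem,
        ← Set.powersetCard.mem_range_ofFinEmbEquiv_symm_iff_mem,
        ← σ.surjective.range_comp,
        ← τ.surjective.range_comp (Set.powersetCard.ofFinEmbEquiv.symm B)]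
      exact iff_of_eq (congrArg (fun f : Fin q → I => i ∈ Set.range f) h)
    subst hAB
    refine Prod.ext rfl (Equiv.ext fun i => ?_)
    exact (Set.powersetCard.ofFinEmbEquiv.symm A).injective (congrFun h i)
  · intro g hg
    refine hΦ g fun hinj => hg ?_
    let A : Set.powersetCard I q := Set.powersetCard.ofFinEmb q I ⟨g, hinj⟩
    have hA : ∀ i, g i ∈ Set.range (Set.powersetCard.ofFinEmbEquiv.symm A) := fun i => by
      rw [Set.powersetCard.mem_range_ofFinEmbEquiv_symm_iff_mem]
      simp [A]
    choose f hf using hA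
    have finj : Function.Injective f := fun i j hij => hinj (by rw [← hf, ← hf, hij])
    exact ⟨(A, Equiv.ofBijective f (Finite.injective_iff_bijective.1 finj)), funext hf⟩

/-- The expansion of a power of a sum in a noncommutative ring. -/
lemma sum_pow_eq_sum_list_prod {X A : Type*} [Fintype X] [Ring A] (f : X → A) (p : ℕ) :
    (∑ x, f x) ^ p = ∑ g : Fin p → X, (List.ofFn fun i => f (g i)).prod := by
  induction p with
  | zero => simp
  | succ p ih =>
    rw [pow_succ', ih, ← (Fin.consEquiv fun _ => X).sum_comp, Fintype.sum_prod_type, Finset.sum_mul]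
    refine Finset.sum_congr rfl fun x _ => ?_
    rw [Finset.mul_sum]
    refine Finset.sum_congr rfl fun g _ => ?_
    simp [List.ofFn_succ, Fin.consEquiv]

/-- The even and the odd indices below `2 m`. -/
def evenOddEquiv (m : ℕ) : Fin m ⊕ Fin m ≃ Fin (2 * m) :=
  Equiv.ofBijective
    (Sum.elim (fun i => ⟨2 * i, by omega⟩) (fun i => ⟨2 * i + 1, by omega⟩)) <| by
    rw [Fintype.bijective_iff_injective_and_card]
    refine ⟨?_, by simp; omega⟩
    rintro (i | i) (j | j) h <;> simp [Fin.ext_iff] at h ⊢ <;> omega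

@[simp]
lemma evenOddEquiv_inl {m : ℕ} (i : Fin m) : evenOddEquiv m (.inl i) = ⟨2 * i, by omega⟩ := rfl

@[simp]
lemma evenOddEquiv_inr {m : ℕ} (i : Fin m) : evenOddEquiv m (.inr i) = ⟨2 * i + 1, by omega⟩ := rfl

/-- A sequence of length `2 m` as a sequence of `m` pairs. -/
def pairsEquiv (m : ℕ) (I : Type*) : (Fin (2 * m) → I) ≃ (Fin m → I × I) :=
  ((evenOddEquiv m).symm.arrowCongr (Equiv.refl I)).trans
    ((Equiv.sumArrowEquivProdArrow _ _ _).trans (Equiv.arrowProdEquivProdArrow _ _ _).symm)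

@[simp]
lemma pairsEquiv_apply {m : ℕ} {I : Type*} (h : Fin (2 * m) → I) (i : Fin m) :
    pairsEquiv m I h i = (h ⟨2 * i, by omega⟩, h ⟨2 * i + 1, by omega⟩) := rfl

lemma list_prod_ofFn_two_mul {A : Type*} [Monoid A] {m : ℕ} (c : Fin (2 * m) → A) :
    (List.ofFn fun i : Fin m => c ⟨2 * i, by omega⟩ * c ⟨2 * i + 1, by omega⟩).prod =
      (List.ofFn c).prod := by
  rw [List.ofFn_mul', List.prod_flatten, List.map_ofFn]
  congr 2
  funext i
  simp [List.ofFn_succ]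

/-- The sum `∑_σ (-1)^σ N_{σ(1) σ(2)} ⋯ N_{σ(2m-1) σ(2m)}`, which is `2^m m!` times the
Pfaffian of `N`. -/
def pfSum {m : ℕ} {A : Type*} [Ring A] [Algebra ℝ A] (N : Matrix (Fin (2 * m)) (Fin (2 * m)) A) :
    A :=
  ∑ σ : Equiv.Perm (Fin (2 * m)), ((Equiv.Perm.sign σ : ℤ) : ℝ) •
    (List.ofFn fun i : Fin m => N (σ ⟨2 * i, by omega⟩) (σ ⟨2 * i + 1, by omega⟩)).prod

lemma map_pfSum {m : ℕ} {A B : Type*} [Ring A] [Algebra ℝ A] [Ring B] [Algebra ℝ B]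
    (φ : A →ₐ[ℝ] B) (N : Matrix (Fin (2 * m)) (Fin (2 * m)) A) :
    φ (pfSum N) = pfSum (N.map φ) := by
  simp only [pfSum, map_sum, map_smul, map_list_prod, List.map_ofFn]
  rfl

variable {W : Type*} [NormedAddCommGroup W] [InnerProductSpace ℝ W] {n : ℕ}

lemma formBasis_powersetCard (s : OrthonormalBasis (Fin n) ℝ W) {q : ℕ}
    (A : Set.powersetCard (Fin n) q) :
    formBasis s A = ExteriorAlgebra.ιMulti ℝ q
      fun i => s.toBasis.coord (Set.powersetCard.ofFinEmbEquiv.symm A i) := by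
  rw [formBasis, ExteriorAlgebra.basis_apply_powersetCard]
  simp only [ExteriorAlgebra.ιMulti_family]
  congr 1
  funext i
  simp

lemma list_prod_tmul {A B : Type*} [Ring A] [Algebra ℝ A] [Ring B] [Algebra ℝ B] {p : ℕ}
    (a : Fin p → A) (b : Fin p → B) :
    (List.ofFn fun i => a i ⊗ₜ[ℝ] b i).prod = (List.ofFn a).prod ⊗ₜ[ℝ] (List.ofFn b).prod := by
  induction p with
  | zero => simp [Algebra.TensorProduct.one_def]
  | succ p ih => simp [List.ofFn_succ, ih, Algebra.TensorProduct.tmul_mul_tmul]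

/-- The powers of a form of degree two with coefficients in an algebra. -/
theorem sum_tmul_pow {A : Type*} [Ring A] [Algebra ℝ A] (Ω : Matrix (Fin n) (Fin n) A)
    (s : OrthonormalBasis (Fin n) ℝ W) (p : ℕ) :
    (∑ a, ∑ b, Ω a b ⊗ₜ[ℝ] (coframe s a * coframe s b)) ^ p =
      ∑ J : Set.powersetCard (Fin n) (2 * p),
        pfSum (Ω.submatrix (Set.powersetCard.ofFinEmbEquiv.symm J)
          (Set.powersetCard.ofFinEmbEquiv.symm J)) ⊗ₜ[ℝ] formBasis s J := by
  rw [← Fintype.sum_prod_type', sum_pow_eq_sum_list_prod, ← (pairsEquiv p (Fin n)).sum_comp]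
  have key : ∀ h : Fin (2 * p) → Fin n,
      (List.ofFn fun i => Ω (pairsEquiv p (Fin n) h i).1 (pairsEquiv p (Fin n) h i).2 ⊗ₜ[ℝ]
        (coframe s (pairsEquiv p (Fin n) h i).1 * coframe s (pairsEquiv p (Fin n) h i).2)).prod =
      (List.ofFn fun i : Fin p => Ω (h ⟨2 * i, by omega⟩) (h ⟨2 * i + 1, by omega⟩)).prod ⊗ₜ[ℝ]
        ExteriorAlgebra.ιMulti ℝ (2 * p) (fun j => s.toBasis.coord (h j)) := by
    intro h
    rw [list_prod_tmul]
    simp only [pairsEquiv_apply]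
    rw [list_prod_ofFn_two_mul (fun j => coframe s (h j)), ExteriorAlgebra.ιMulti_apply]
    rfl
  simp only [key]
  -- A repeated index kills the wedge product, so only orderings of subsets `J` survive. Sorting an
  -- ordering costs its sign, which produces `pfSum`.
  rw [sum_eq_sum_powersetCard_perm]
  · refine Finset.sum_congr rfl fun J _ => ?_
    rw [pfSum, TensorProduct.sum_tmul]
    refine Finset.sum_congr rfl fun σ _ => ?_
    have := (ExteriorAlgebra.ιMulti ℝ (M := Dual ℝ W) (2 * p)).map_perm
      (fun j => s.toBasis.coord (Set.powersetCard.ofFinEmbEquiv.symm J j)) σ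
    rw [formBasis_powersetCard, ← TensorProduct.smul_tmul']
    erw [this]
    rw [Units.smul_def, ← TensorProduct.tmul_smul, Int.cast_smul_eq_zsmul]
    rfl
  · intro g hg
    rw [AlternatingMap.map_eq_zero_of_not_injective, TensorProduct.tmul_zero]
    exact fun h => hg (Function.Injective.of_comp (f := fun a => s.toBasis.coord a) h)

end Expansion

/-! ### Pfaffians over a commutative ring: congruence and square roots -/

section Pfaffian

variable {S : Type*} [CommRing S] {m : ℕ}

lemma prod_evenOdd (f : Fin (2 * m) → S) :
    ∏ i : Fin m, (f ⟨2 * i, by omega⟩ * f ⟨2 * i + 1, by omega⟩) = ∏ j, f j := by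
  rw [← (evenOddEquiv m).prod_comp, Fintype.prod_sum_type, Finset.prod_mul_distrib]
  simp

lemma pfSum_eq_sum_prod [Algebra ℝ S] (N : Matrix (Fin (2 * m)) (Fin (2 * m)) S) :
    pfSum N = ∑ σ : Equiv.Perm (Fin (2 * m)), (Equiv.Perm.sign σ : S) *
      ∏ i : Fin m, N (σ ⟨2 * i, by omega⟩) (σ ⟨2 * i + 1, by omega⟩) := by
  refine Finset.sum_congr rfl fun σ _ => ?_
  rw [List.prod_ofFn, Int.cast_smul_eq_zsmul, zsmul_eq_mul]

/-- After multiplying out, each choice `h` of inner indices carries the determinant of the matrix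
whose columns are the columns `h j` of `B`. This vanishes unless `h` is a permutation, and then it
is `sign h * det B`. -/
theorem pfSum_mul_mul_transpose [Algebra ℝ S] (B N : Matrix (Fin (2 * m)) (Fin (2 * m)) S) :
    pfSum (B * N * B.transpose) = B.det * pfSum N := by
  have h1 : ∀ σ : Equiv.Perm (Fin (2 * m)),
      ∏ i : Fin m, (B * N * B.transpose) (σ ⟨2 * i, by omega⟩) (σ ⟨2 * i + 1, by omega⟩) =
      ∑ h : Fin (2 * m) → Fin (2 * m), (∏ j, B (σ j) (h j)) *
        ∏ i : Fin m, N (h ⟨2 * i, by omega⟩) (h ⟨2 * i + 1, by omega⟩) := by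
    intro σ
    have : ∀ x y, (B * N * B.transpose) x y =
        ∑ p : Fin (2 * m) × Fin (2 * m), (B x p.1 * B y p.2) * N p.1 p.2 := by
      intro x y
      rw [Fintype.sum_prod_type, Finset.sum_comm]
      simp only [Matrix.mul_apply, Matrix.transpose_apply, Finset.sum_mul]
      exact Finset.sum_congr rfl fun _ _ => Finset.sum_congr rfl fun _ _ => by ring
    simp only [this]
    rw [Finset.prod_univ_sum, Fintype.piFinset_univ, ← (pairsEquiv m (Fin (2 * m))).sum_comp]
    refine Finset.sum_congr rfl fun h _ => ?_
    rw [Finset.prod_mul_distrib, ← prod_evenOdd]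
    rfl
  rw [pfSum_eq_sum_prod]
  simp only [h1, Finset.mul_sum]
  rw [Finset.sum_comm]
  have h2 : ∀ h : Fin (2 * m) → Fin (2 * m), ∑ σ : Equiv.Perm (Fin (2 * m)),
      (Equiv.Perm.sign σ : S) * ((∏ j, B (σ j) (h j)) *
        ∏ i : Fin m, N (h ⟨2 * i, by omega⟩) (h ⟨2 * i + 1, by omega⟩)) =
      (B.submatrix id h).det * ∏ i : Fin m, N (h ⟨2 * i, by omega⟩) (h ⟨2 * i + 1, by omega⟩) := by
    intro h
    rw [Matrix.det_apply', Finset.sum_mul]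
    exact Finset.sum_congr rfl fun σ _ => by simp [mul_assoc]
  simp only [h2]
  rw [pfSum_eq_sum_prod, Finset.mul_sum]
  symm
  refine Fintype.sum_of_injective (fun τ : Equiv.Perm (Fin (2 * m)) => (τ : _ → _))
    DFunLike.coe_injective _ _ ?_ ?_
  · intro h hh
    have : ¬ Function.Injective h := fun hi =>
      hh ⟨Equiv.ofBijective h (Finite.injective_iff_bijective.1 hi), rfl⟩
    rw [Function.not_injective_iff] at this
    obtain ⟨i, j, hij, hne⟩ := this
    rw [Matrix.det_zero_of_column_eq hne fun k => by simp [hij], zero_mul]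
  · intro τ
    rw [Matrix.det_permute']
    ring

/-- Truncations of the binomial series of the square root. -/
lemma exists_polynomial_sqrt (N : ℕ) :
    ∃ p : Polynomial ℝ, p.coeff 0 = 1 ∧
      (Polynomial.X : Polynomial ℝ) ^ (N + 1) ∣ p ^ 2 - (1 + Polynomial.X) := by
  induction N with
  | zero => exact ⟨1, by simp, -1, by ring⟩
  | succ N ih =>
    obtain ⟨p, hp, r, hr⟩ := ih
    obtain ⟨t, ht⟩ : (Polynomial.X : Polynomial ℝ) ∣ 1 - p := by
      rw [Polynomial.X_dvd_iff]
      simp [hp]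
    have h2 : Polynomial.C (1 / 2 : ℝ) * 2 = 1 := by
      rw [← Polynomial.C_ofNat, ← Polynomial.C_mul]
      norm_num
    -- A Newton step: as `p ≡ 1` modulo `X`, the derivative of the square is `2` to leading order,
    -- so half of the error is subtracted. The new error is `(1 - p) r X^(N+1) + ¼ r² X^(2N+2)`,
    -- divisible by `X^(N+2)`.
    refine ⟨p - Polynomial.C (1 / 2) * Polynomial.X ^ (N + 1) * r, by simp [hp, mul_assoc],
      t * r + Polynomial.C (1 / 2) ^ 2 * Polynomial.X ^ N * r ^ 2, ?_⟩
    linear_combination hr + r * Polynomial.X ^ (N + 1) * ht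
      - p * r * Polynomial.X ^ (N + 1) * h2

/-- A matrix with nilpotent entries is nilpotent. -/
lemma isNilpotent_matrix_of_forall_entry {ν : Type*} [Fintype ν] [DecidableEq ν]
    {N : Matrix ν ν S} (hN : ∀ i j, IsNilpotent (N i j)) : IsNilpotent N := by
  -- The entries generate a finitely generated ideal inside the nilradical, hence a nilpotent one,
  -- and the entries of `N ^ r` lie in its `r`-th power.
  set I : Ideal S := Ideal.span (Set.range fun p : ν × ν => N p.1 p.2)
  have hfg : I.FG := ⟨(Set.finite_range fun p : ν × ν => N p.1 p.2).toFinset, by simp [I]⟩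
  have hle : I ≤ nilradical S := by
    rw [Ideal.span_le]
    rintro _ ⟨p, rfl⟩
    exact mem_nilradical.2 (hN p.1 p.2)
  obtain ⟨r, hr⟩ := hfg.isNilpotent_iff_le_nilradical.2 hle
  have mem : ∀ r i j, (N ^ r) i j ∈ I ^ r := by
    intro r
    induction r with
    | zero => simp
    | succ r ih =>
      intro i j
      rw [pow_succ, pow_succ, Matrix.mul_apply]
      exact Ideal.sum_mem _ fun k _ => Ideal.mul_mem_mul (ih i k) (Ideal.subset_span ⟨(k, j), rfl⟩)
  refine ⟨r, ?_⟩
  ext i j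
  simpa [hr] using mem r i j

/-- The standard symplectic matrix. -/
def symplecticMatrix (m : ℕ) (S : Type*) [CommRing S] : Matrix (Fin (2 * m)) (Fin (2 * m)) S :=
  Matrix.reindex (evenOddEquiv m) (evenOddEquiv m) (Matrix.fromBlocks 0 1 (-1) 0)

lemma symplecticMatrix_mul_self : symplecticMatrix m S * symplecticMatrix m S = -1 := by
  have h : (Matrix.fromBlocks 0 1 (-1) 0 : Matrix (Fin m ⊕ Fin m) (Fin m ⊕ Fin m) S) *
      Matrix.fromBlocks 0 1 (-1) 0 = -1 := by
    rw [← Matrix.fromBlocks_one, Matrix.fromBlocks_multiply, Matrix.fromBlocks_neg]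
    simp
  change Matrix.reindexAlgEquiv S S (evenOddEquiv m) _ *
    Matrix.reindexAlgEquiv S S (evenOddEquiv m) _ = _
  rw [← map_mul, h, map_neg, map_one]

lemma symplecticMatrix_transpose : (symplecticMatrix m S).transpose = -symplecticMatrix m S := by
  rw [symplecticMatrix, Matrix.transpose_reindex, Matrix.fromBlocks_transpose]
  change Matrix.reindexAlgEquiv S S (evenOddEquiv m) _ =
    - Matrix.reindexAlgEquiv S S (evenOddEquiv m) _
  rw [← map_neg, Matrix.fromBlocks_neg]
  simp

lemma det_symplecticMatrix : (symplecticMatrix m S).det = 1 := by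
  -- A quarter turn is a product of three shears, each of determinant one.
  have : (Matrix.fromBlocks 0 1 (-1) 0 : Matrix (Fin m ⊕ Fin m) (Fin m ⊕ Fin m) S) =
      Matrix.fromBlocks 1 1 0 1 * Matrix.fromBlocks 1 0 (-1) 1 * Matrix.fromBlocks 1 1 0 1 := by
    simp [Matrix.fromBlocks_multiply]
  rw [symplecticMatrix, Matrix.det_reindex_self, this]
  simp

lemma map_symplecticMatrix {S' : Type*} [CommRing S'] (φ : S →+* S') :
    (symplecticMatrix m S).map φ = symplecticMatrix m S' := by
  simp only [symplecticMatrix, Matrix.reindex_apply, ← Matrix.submatrix_map, Matrix.fromBlocks_map]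
  have : (-1 : Matrix (Fin m) (Fin m) S).map φ = -1 := by
    simpa using map_neg φ.mapMatrix (1 : Matrix (Fin m) (Fin m) S)
  simp [this]

/-- `J + N` is congruent to `J` if `N` is skew with nilpotent entries. -/
lemma exists_mul_symplecticMatrix_mul_transpose [Algebra ℝ S]
    {N : Matrix (Fin (2 * m)) (Fin (2 * m)) S}
    (hskew : N.transpose = -N) (hN : ∀ i j, IsNilpotent (N i j)) :
    ∃ B : Matrix (Fin (2 * m)) (Fin (2 * m)) S,
      B * symplecticMatrix m S * B.transpose = symplecticMatrix m S + N := by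
  set J := symplecticMatrix m S with hJ
  have hJJ : J * J = -1 := symplecticMatrix_mul_self
  have hJt : J.transpose = -J := symplecticMatrix_transpose
  -- Since `J² = -1`, this choice gives `J + N = (1 + x) J`. The congruence will be by `B = √(1 +
  -- x)`, a polynomial in the nilpotent matrix `x`.
  set x := -(N * J) with hx
  have hnil : IsNilpotent x := by
    refine isNilpotent_matrix_of_forall_entry fun i j => mem_nilradical.1 ?_
    rw [hx, Matrix.neg_apply, Matrix.mul_apply]
    exact neg_mem (Ideal.sum_mem _ fun k _ =>
      Ideal.mul_mem_right _ _ (mem_nilradical.2 (hN i k)))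
  obtain ⟨r, hr⟩ := hnil
  obtain ⟨p, -, q, hq⟩ := exists_polynomial_sqrt r
  -- Skewness of `N` and `J` gives `J xᵀ = x J`. The relation passes to polynomials in `x`, so `B J
  -- Bᵀ = B² J = (1 + x) J`.
  have semi : SemiconjBy J x.transpose x := by
    rw [SemiconjBy, hx, Matrix.transpose_neg, Matrix.transpose_mul, hskew, hJt]
    simp only [neg_mul, mul_neg, neg_neg, mul_assoc, hJJ]
    simp only [← mul_assoc, hJJ]
    simp
  have comm : ∀ p : Polynomial ℝ,
      J * (Polynomial.aeval x p).transpose = Polynomial.aeval x p * J := by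
    intro p
    induction p using Polynomial.induction_on' with
    | add p q hp hq => rw [map_add, Matrix.transpose_add, mul_add, add_mul, hp, hq]
    | monomial d c =>
      rw [Polynomial.aeval_monomial, ← Algebra.smul_def, Matrix.transpose_smul,
        Matrix.transpose_pow, mul_smul_comm, smul_mul_assoc, (semi.pow_right d).eq]
  refine ⟨Polynomial.aeval x p, ?_⟩
  have sq : Polynomial.aeval x p * Polynomial.aeval x p = 1 + x := by
    have := congrArg (Polynomial.aeval x) hq
    simp only [map_sub, map_mul, map_pow, map_add, map_one, Polynomial.aeval_X, pow_succ, hr,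
      zero_mul, pow_zero, one_mul] at this
    exact sub_eq_zero.1 this
  rw [mul_assoc, comm, ← mul_assoc, sq, add_mul, one_mul, hx, neg_mul, mul_assoc, hJJ]
  simp

/-- A sum of `|t|` commuting elements of square zero. -/
lemma sum_pow_card_of_sq_eq_zero {ι : Type*} [DecidableEq ι] (x : ι → S) (hx : ∀ i, x i ^ 2 = 0)
    (t : Finset ι) :
    (∑ i ∈ t, x i) ^ t.card = (t.card.factorial : S) * ∏ i ∈ t, x i ∧
      (∑ i ∈ t, x i) ^ (t.card + 1) = 0 := by
  induction t using Finset.induction_on with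
  | empty => simp
  | insert a t ha ih =>
    -- The binomial expansion stops at the linear term because `x a` has square zero.
    have key : ∀ p : ℕ, (x a + ∑ i ∈ t, x i) ^ (p + 1) =
        (∑ i ∈ t, x i) ^ (p + 1) + (p + 1) * x a * (∑ i ∈ t, x i) ^ p := by
      intro p
      induction p with
      | zero => simp; ring
      | succ p ihp =>
        rw [pow_succ, ihp]
        push_cast
        linear_combination (p + 1) * (∑ i ∈ t, x i) ^ p * hx a
    rw [Finset.card_insert_of_notMem ha, Finset.sum_insert ha, Finset.prod_insert ha]
    refine ⟨?_, ?_⟩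
    · rw [key, ih.2, ih.1, Nat.factorial_succ]
      push_cast
      ring
    · rw [key, ih.2, pow_succ, ih.2]
      simp

end Pfaffian

/-! ### Even forms are central -/

section Center

variable {W : Type*} [AddCommGroup W] [Module ℝ W]

/-- A one-form passing two others changes sign twice. Curvature two-forms thus lie in a commutative
algebra, where determinants and the Pfaffian identities make sense. -/
lemma ι_mul_ι_mem_center (u v : W) :
    ExteriorAlgebra.ι ℝ u * ExteriorAlgebra.ι ℝ v ∈ Subalgebra.center ℝ (ExteriorAlgebra ℝ W) := by
  have anti : ∀ u v : W, ExteriorAlgebra.ι ℝ u * ExteriorAlgebra.ι ℝ v =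
      - (ExteriorAlgebra.ι ℝ v * ExteriorAlgebra.ι ℝ u) := fun u v =>
    eq_neg_of_add_eq_zero_left (ExteriorAlgebra.ι_add_mul_swap u v)
  rw [Subalgebra.mem_center_iff]
  intro x
  induction x using ExteriorAlgebra.induction with
  | algebraMap r => exact Algebra.commutes r _
  | ι w =>
    rw [mul_assoc, anti v w, mul_neg, ← mul_assoc, ← mul_assoc, anti u w, neg_mul, neg_neg]
  | mul a b ha hb => rw [mul_assoc, hb, ← mul_assoc, ha, mul_assoc]
  | add a b ha hb => rw [add_mul, mul_add, ha, hb]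

lemma ι_mul_ι_sq (u v : W) :
    (ExteriorAlgebra.ι ℝ u * ExteriorAlgebra.ι ℝ v) ^ 2 = 0 := by
  have h := (Subalgebra.mem_center_iff (R := ℝ)).1 (ι_mul_ι_mem_center u v) (ExteriorAlgebra.ι ℝ u)
  rw [sq, ← mul_assoc, ← h, ← mul_assoc, ExteriorAlgebra.ι_sq_zero, zero_mul, zero_mul]

end Center

/-! ### Top powers and the normalization of the Pfaffian -/

section TopDegree

variable {W : Type*} [NormedAddCommGroup W] [InnerProductSpace ℝ W] {n : ℕ}

lemma ofFinEmbEquiv_symm_eq_cast {q : ℕ} (h : q = n) (J : Set.powersetCard (Fin n) q)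
    (i : Fin q) : Set.powersetCard.ofFinEmbEquiv.symm J i = Fin.cast h i := by
  have hJ : J.val = Finset.univ := by
    rw [← Finset.card_eq_iff_eq_univ, Fintype.card_fin]
    exact (show J.val.card = q from J.2).trans h
  have := Finset.orderEmbOfFin_unique' J.2 (f := (Fin.castOrderIso h).toOrderEmbedding)
    (fun x => by rw [hJ]; exact Finset.mem_univ _)
  rw [Set.powersetCard.ofFinEmbEquiv_symm_apply, ← this]
  rfl

/-- The top power of a form of degree two with coefficients in an algebra. -/
theorem sum_tmul_pow_top {A : Type*} [Ring A] [Algebra ℝ A] (Ω : Matrix (Fin n) (Fin n) A)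
    (s : OrthonormalBasis (Fin n) ℝ W) {p : ℕ} (h : 2 * p = n) :
    (∑ a, ∑ b, Ω a b ⊗ₜ[ℝ] (coframe s a * coframe s b)) ^ p =
      pfSum (Ω.submatrix (Fin.cast h) (Fin.cast h)) ⊗ₜ[ℝ] volumeElement s := by
  rw [sum_tmul_pow]
  have huniv : ∀ J : Set.powersetCard (Fin n) (2 * p), J.val = Finset.univ := fun J => by
    rw [← Finset.card_eq_iff_eq_univ, Fintype.card_fin]
    exact (show J.val.card = 2 * p from J.2).trans h
  rw [Fintype.sum_eq_single (⟨Finset.univ, by simp [h]⟩ : Set.powersetCard (Fin n) (2 * p))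
    fun J hJ => absurd (Subtype.ext (huniv J)) hJ]
  congr 2
  ext a b
  simp [ofFinEmbEquiv_symm_eq_cast h]

lemma symplecticMatrix_real_sum {A : Type*} [AddCommGroup A] [Module ℝ A] {m : ℕ}
    (f : Fin (2 * m) → Fin (2 * m) → A) :
    ∑ a, ∑ b, symplecticMatrix m ℝ a b • f a b =
      ∑ i : Fin m, (f ⟨2 * i, by omega⟩ ⟨2 * i + 1, by omega⟩ -
        f ⟨2 * i + 1, by omega⟩ ⟨2 * i, by omega⟩) := by
  rw [← (evenOddEquiv m).sum_comp]
  simp only [← (evenOddEquiv m).sum_comp (fun b => symplecticMatrix m ℝ _ b • f _ b),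
    Fintype.sum_sum_type]
  simp [symplecticMatrix, Matrix.one_apply, Finset.sum_add_distrib, sub_eq_add_neg,
    -evenOddEquiv_inl, -evenOddEquiv_inr]
  rfl

/-- The value is read off from the top power of the symplectic form. That form is twice a sum of `m`
commuting elements of square zero whose product is the volume element, so its `m`-th power is `2^m
m!` times that element. -/
lemma pfSum_symplecticMatrix_real (m : ℕ) :
    pfSum (symplecticMatrix m ℝ) = 2 ^ m * m.factorial := by
  set s := EuclideanSpace.basisFun (Fin (2 * m)) ℝ
  have h := sum_tmul_pow_top (symplecticMatrix m ℝ) s (p := m) rfl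
  simp only [Fin.cast_refl] at h
  set c : Fin (2 * m) → Forms (EuclideanSpace ℝ (Fin (2 * m))) := coframe s
  let x : Fin m → Subalgebra.center ℝ (Forms (EuclideanSpace ℝ (Fin (2 * m)))) := fun i =>
    ⟨c ⟨2 * i, by omega⟩ * c ⟨2 * i + 1, by omega⟩, ι_mul_ι_mem_center _ _⟩
  have hx : ∀ i, x i ^ 2 = 0 := fun i => Subtype.ext (ι_mul_ι_sq _ _)
  have h1 : ∑ a, ∑ b, symplecticMatrix m ℝ a b ⊗ₜ[ℝ] (c a * c b) =
      (1 : ℝ) ⊗ₜ[ℝ] ((2 : ℝ) • ((∑ i, x i :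
        Subalgebra.center ℝ (Forms (EuclideanSpace ℝ (Fin (2 * m))))) : Forms _)) := by
    have : ∀ a b, symplecticMatrix m ℝ a b ⊗ₜ[ℝ] (c a * c b) =
        symplecticMatrix m ℝ a b • ((1 : ℝ) ⊗ₜ[ℝ] (c a * c b)) := fun a b => by
      rw [TensorProduct.smul_tmul', smul_eq_mul, mul_one]
    simp only [this]
    refine (symplecticMatrix_real_sum fun a b => (1 : ℝ) ⊗ₜ[ℝ] (c a * c b)).trans ?_
    rw [AddSubmonoidClass.coe_finsetSum, Finset.smul_sum,
      TensorProduct.tmul_sum]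
    refine Finset.sum_congr rfl fun i _ => ?_
    rw [← TensorProduct.tmul_sub, two_smul, sub_eq_add_neg]
    congr 2
    exact (eq_neg_of_add_eq_zero_left (ExteriorAlgebra.ι_add_mul_swap _ _)).symm
  have h2 := (sum_pow_card_of_sq_eq_zero x hx Finset.univ).1
  have h3 : ((∏ i, x i : Subalgebra.center ℝ (Forms (EuclideanSpace ℝ (Fin (2 * m))))) :
      Forms _) = volumeElement s := by
    have hc : (⟨Finset.univ, by simp⟩ : Set.powersetCard (Fin (2 * m)) (2 * m)).val = Finset.univ :=
      rfl
    rw [volumeElement, ← hc, formBasis_powersetCard, ExteriorAlgebra.ιMulti_apply]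
    simp only [ofFinEmbEquiv_symm_eq_cast (rfl : 2 * m = 2 * m)]
    change _ = (List.ofFn c).prod
    rw [← list_prod_ofFn_two_mul, ← List.prod_ofFn]
    change (Subalgebra.center ℝ _).val _ = _
    rw [map_list_prod, List.map_ofFn]
    rfl
  rw [h1, Algebra.TensorProduct.tmul_pow, one_pow, smul_pow, ← SubmonoidClass.coe_pow] at h
  rw [Finset.card_univ, Fintype.card_fin] at h2
  rw [h2] at h
  have h4 : (((m.factorial : Subalgebra.center ℝ (Forms (EuclideanSpace ℝ (Fin (2 * m))))) *
      ∏ i, x i : Subalgebra.center ℝ _) : Forms (EuclideanSpace ℝ (Fin (2 * m)))) =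
      (m.factorial : ℝ) • volumeElement s := by
    rw [MulMemClass.coe_mul, h3, Nat.cast_smul_eq_nsmul, nsmul_eq_mul]
    rfl
  rw [h4, smul_smul, TensorProduct.tmul_smul, TensorProduct.smul_tmul', smul_eq_mul, mul_one] at h
  have h5 := congrArg (TensorProduct.lid ℝ _) h
  rw [TensorProduct.lid_tmul, TensorProduct.lid_tmul] at h5
  exact (smul_left_injective ℝ ((formBasis s).ne_zero Finset.univ) h5).symm

end TopDegree

/-! ### The determinant is the square of the Pfaffian -/

section DetPfaffian

variable {S : Type*} [CommRing S] [Algebra ℝ S] {m : ℕ}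

lemma pfSum_symplecticMatrix :
    pfSum (symplecticMatrix m S) = algebraMap ℝ S (2 ^ m * m.factorial) := by
  rw [← pfSum_symplecticMatrix_real, ← Algebra.ofId_apply, map_pfSum]
  congr 1
  exact (map_symplecticMatrix (algebraMap ℝ S)).symm

lemma pfSum_smul (t : S) (N : Matrix (Fin (2 * m)) (Fin (2 * m)) S) :
    pfSum (t • N) = t ^ m * pfSum N := by
  simp only [pfSum_eq_sum_prod, Matrix.smul_apply, smul_eq_mul, Finset.prod_mul_distrib,
    Finset.prod_const, Finset.card_univ, Fintype.card_fin, Finset.mul_sum]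
  exact Finset.sum_congr rfl fun _ _ => by ring

lemma pfSum_symplecticMatrix_add_sq {N : Matrix (Fin (2 * m)) (Fin (2 * m)) S}
    (hskew : N.transpose = -N) (hN : ∀ i j, IsNilpotent (N i j)) :
    pfSum (symplecticMatrix m S + N) ^ 2 =
      algebraMap ℝ S (2 ^ m * m.factorial) ^ 2 * (symplecticMatrix m S + N).det := by
  obtain ⟨B, hB⟩ := exists_mul_symplecticMatrix_mul_transpose hskew hN
  rw [← hB, pfSum_mul_mul_transpose, pfSum_symplecticMatrix, Matrix.det_mul, Matrix.det_mul,
    Matrix.det_transpose, det_symplecticMatrix]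
  ring

/-- The determinant of a skew matrix with nilpotent entries is the square of its Pfaffian. -/
theorem pfSum_sq {N : Matrix (Fin (2 * m)) (Fin (2 * m)) S}
    (hskew : N.transpose = -N) (hN : ∀ i j, IsNilpotent (N i j)) :
    pfSum N ^ 2 = algebraMap ℝ S (2 ^ m * m.factorial) ^ 2 * N.det := by
  -- Congruence to `J` is available only for nilpotent perturbations of `J`, so `N` is deformed to
  -- `X J + N`. The identity is proved with `X` inverted and then specialized to `X = 0`.
  set P : Matrix (Fin (2 * m)) (Fin (2 * m)) (Polynomial S) :=
    (Polynomial.X : Polynomial S) • symplecticMatrix m (Polynomial S) + N.map Polynomial.C with hP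
  have key : pfSum P ^ 2 = algebraMap ℝ (Polynomial S) (2 ^ m * m.factorial) ^ 2 * P.det := by
    let φ : Polynomial S →ₐ[ℝ] LaurentPolynomial S :=
      (Polynomial.toLaurentAlg (R := S)).restrictScalars ℝ
    have hφ : Function.Injective φ := Polynomial.toLaurent_injective (R := S)
    apply hφ
    let N' : Matrix (Fin (2 * m)) (Fin (2 * m)) (LaurentPolynomial S) :=
      (LaurentPolynomial.T (-1) : LaurentPolynomial S) • N.map (LaurentPolynomial.C (R := S))
    have hskew' : N'.transpose = -N' := by
      rw [Matrix.transpose_smul, ← Matrix.transpose_map, hskew, ← smul_neg]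
      congr 1
      ext i j
      simp
    have hN' : ∀ i j, IsNilpotent (N' i j) := fun i j =>
      (Commute.all _ _).isNilpotent_mul_left ((hN i j).map LaurentPolynomial.C)
    -- Over Laurent polynomials `X J + N = X (J + X⁻¹ N)`, and `X⁻¹ N` is still skew with nilpotent
    -- entries. Both sides of the identity scale by `X^(2m)`.
    have hmap : P.map φ =
        (LaurentPolynomial.T 1 : LaurentPolynomial S) •
          (symplecticMatrix m (LaurentPolynomial S) + N') := by
      rw [smul_add, smul_smul, ← LaurentPolynomial.T_add, ← map_symplecticMatrix
        (φ : Polynomial S →+* LaurentPolynomial S)]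
      ext1 i j
      have hX : φ Polynomial.X = LaurentPolynomial.T 1 := Polynomial.toLaurent_X
      have hC : φ (Polynomial.C (N i j)) = LaurentPolynomial.C (N i j) := Polynomial.toLaurent_C _
      change φ (Polynomial.X * symplecticMatrix m (Polynomial S) i j + Polynomial.C (N i j)) =
        LaurentPolynomial.T 1 * φ (symplecticMatrix m (Polynomial S) i j) +
          LaurentPolynomial.T (1 + -1) * LaurentPolynomial.C (N i j)
      rw [map_add, map_mul, hX, hC, add_neg_cancel, LaurentPolynomial.T_zero, one_mul]
    have := pfSum_symplecticMatrix_add_sq hskew' hN'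
    rw [map_pow, map_pfSum, map_mul, map_pow, AlgHom.commutes]
    have hdet : φ P.det = (P.map φ).det := φ.map_det P
    rw [hdet, hmap, pfSum_smul, Matrix.det_smul, mul_pow, this, Fintype.card_fin]
    ring
  let ψ : Polynomial S →ₐ[ℝ] S := (Polynomial.aeval (R := S) (0 : S)).restrictScalars ℝ
  have hmap : P.map ψ = N := by
    ext i j
    simp [hP, ψ]
  have := congrArg ψ key
  have hdet : ψ P.det = (P.map ψ).det := ψ.map_det P
  rwa [map_pow, map_pfSum, map_mul, map_pow, AlgHom.commutes, hdet, hmap] at this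

end DetPfaffian

/-! ### Hodge star, wedge pairing and norms of components -/

section Hodge

variable {T : Type*} [NormedAddCommGroup T] [InnerProductSpace ℝ T]
  {W : Type*} [NormedAddCommGroup W] [InnerProductSpace ℝ W] {n m : ℕ}

/-- The coefficient of `e¹ ∧ ⋯ ∧ eⁿ` in `e^I ∧ e^{Iᶜ}`. -/
def complSign (e : OrthonormalBasis (Fin n) ℝ T) (I : Finset (Fin n)) : ℝ :=
  (formBasis e).repr (formBasis e I * formBasis e Iᶜ) Finset.univ

lemma formBasis_mul_compl (e : OrthonormalBasis (Fin n) ℝ T) (I : Finset (Fin n)) :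
    formBasis e I * formBasis e Iᶜ = complSign e I • volumeElement e ∧ complSign e I ^ 2 = 1 := by
  let s : Set.powersetCard (Fin n) I.card := ⟨I, rfl⟩
  let t : Set.powersetCard (Fin n) Iᶜ.card := ⟨Iᶜ, rfl⟩
  have hst : Disjoint s.val t.val := disjoint_compl_right
  have h := ExteriorAlgebra.basis_mul_of_disjoint e.toBasis.dualBasis s t hst
  have hu : ((Set.powersetCard.disjUnion hst : Set.powersetCard (Fin n) _) : Finset (Fin n)) =
      Finset.univ := by
    simp [s, t]
  rw [hu] at h
  change formBasis e I * formBasis e Iᶜ = _ • volumeElement e at h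
  have hc : complSign e I =
      (((Set.powersetCard.permOfDisjoint hst).sign : ℤ) : ℝ) := by
    rw [complSign, h, Units.smul_def, ← Int.cast_smul_eq_zsmul ℝ, map_smul, volumeElement]
    simp
  refine ⟨?_, ?_⟩
  · rw [h, hc, Units.smul_def, Int.cast_smul_eq_zsmul]
  · rw [hc]
    norm_cast
    simp [sq]

lemma formBasis_mul_eq_zero (e : OrthonormalBasis (Fin n) ℝ T) {I K : Finset (Fin n)}
    (hIK : I.card + K.card = n) (h : K ≠ Iᶜ) : formBasis e I * formBasis e K = 0 := by
  refine ExteriorAlgebra.basis_mul_of_not_disjoint e.toBasis.dualBasis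
    (⟨I, rfl⟩ : Set.powersetCard (Fin n) I.card) (⟨K, rfl⟩ : Set.powersetCard (Fin n) K.card)
    fun hd => h ?_
  refine Finset.eq_of_subset_of_card_le ?_ ?_
  · exact (Finset.subset_compl_comm.1 (Finset.subset_compl_iff_disjoint_right.2 hd))
  · rw [Finset.card_compl, Fintype.card_fin]
    omega

lemma formBasis_mem_center (e : OrthonormalBasis (Fin n) ℝ T) {p : ℕ} {I : Finset (Fin n)}
    (hI : I.card = 2 * p) : formBasis e I ∈ Subalgebra.center ℝ (Forms T) := by
  have h := formBasis_powersetCard e (⟨I, hI⟩ : Set.powersetCard (Fin n) (2 * p))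
  rw [ExteriorAlgebra.ιMulti_apply, ← list_prod_ofFn_two_mul] at h
  change formBasis e I = _ at h
  rw [h]
  refine Subalgebra.list_prod_mem _ fun x hx => ?_
  obtain ⟨i, rfl⟩ := List.mem_ofFn.1 hx
  exact ι_mul_ι_mem_center _ _

/-- An even form is central, so `e^I` and `e^{Iᶜ}` commute. This is what makes the star an
involution in even middle degree. -/
lemma complSign_compl (e : OrthonormalBasis (Fin n) ℝ T) {p : ℕ} {I : Finset (Fin n)}
    (hI : I.card = 2 * p) : complSign e Iᶜ = complSign e I := by
  rw [complSign, complSign, compl_compl,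
    (Subalgebra.mem_center_iff (R := ℝ)).1 (formBasis_mem_center e hI)]

lemma repr_hodgeStar (e : OrthonormalBasis (Fin n) ℝ T) (α : Forms T) (I : Finset (Fin n)) :
    (formBasis e).repr (hodgeStar e α) I = complSign e Iᶜ * (formBasis e).repr α Iᶜ := by
  have h : ((formBasis e).coord I).comp (hodgeStar e) =
      complSign e Iᶜ • (formBasis e).coord Iᶜ := by
    refine (formBasis e).ext fun K => ?_
    have : hodgeStar e (formBasis e K) = complSign e K • formBasis e Kᶜ := by
      rw [hodgeStar, Basis.constr_basis]
      rfl
    rw [LinearMap.comp_apply, this]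
    by_cases hK : K = Iᶜ
    · subst hK
      simp
    · have hK' : Kᶜ ≠ I := fun h => hK (by rw [← h, compl_compl])
      simp [hK, hK']
  exact LinearMap.congr_fun h α

lemma repr_dualProj (e : OrthonormalBasis (Fin n) ℝ T) (ε : ℤˣ) (α : Forms T)
    (I : Finset (Fin n)) :
    (formBasis e).repr (dualProj e ε α) I = 1 / 2 * ((formBasis e).repr α I +
      ((ε : ℤ) : ℝ) * (complSign e Iᶜ * (formBasis e).repr α Iᶜ)) := by
  simp [dualProj, repr_hodgeStar, mul_add]

lemma repr_component (e : OrthonormalBasis (Fin n) ℝ T) (s : OrthonormalBasis (Fin m) ℝ W)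
    (ε δ : ℤˣ) (B : BiForms T W) (I : Finset (Fin n)) (J : Finset (Fin m)) :
    ((formBasis e).tensorProduct (formBasis s)).repr (component e s ε δ B) (I, J) =
      1 / 4 * (((formBasis e).tensorProduct (formBasis s)).repr B (I, J)
        + ((ε : ℤ) : ℝ) * complSign e Iᶜ *
          ((formBasis e).tensorProduct (formBasis s)).repr B (Iᶜ, J)
        + ((δ : ℤ) : ℝ) * complSign s Jᶜ *
          ((formBasis e).tensorProduct (formBasis s)).repr B (I, Jᶜ)
        + ((ε : ℤ) : ℝ) * ((δ : ℤ) : ℝ) * complSign e Iᶜ * complSign s Jᶜ *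
          ((formBasis e).tensorProduct (formBasis s)).repr B (Iᶜ, Jᶜ)) := by
  induction B using TensorProduct.induction_on with
  | zero => simp [component]
  | tmul α β =>
    rw [component, TensorProduct.map_tmul]
    simp only [Basis.tensorProduct_repr_tmul_apply, repr_dualProj, smul_eq_mul]
    ring
  | add B C hB hC =>
    rw [component] at hB hC ⊢
    simp only [map_add, Finsupp.add_apply, hB, hC]
    ring

/-- Both factors live in half the top degree, so only complementary index sets contribute. For even
`p` the coefficient is `⟨α, *β⟩`. -/
lemma mul_eq_smul_volumeElement (e : OrthonormalBasis (Fin n) ℝ T) {p : ℕ} (hn : p + p = n)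
    {α β : Forms T} (hα : ∀ I : Finset (Fin n), I.card ≠ p → (formBasis e).repr α I = 0)
    (hβ : ∀ I : Finset (Fin n), I.card ≠ p → (formBasis e).repr β I = 0) :
    α * β = (∑ I, complSign e I * (formBasis e).repr α I * (formBasis e).repr β Iᶜ) •
      volumeElement e := by
  conv_lhs => rw [← (formBasis e).sum_repr α, ← (formBasis e).sum_repr β]
  rw [Finset.sum_mul_sum, Finset.sum_smul]
  refine Finset.sum_congr rfl fun I _ => ?_
  by_cases hI : I.card = p
  swap
  · simp [hα I hI]
  rw [Fintype.sum_eq_single Iᶜ]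
  · rw [smul_mul_smul_comm, (formBasis_mul_compl e I).1, smul_smul]
    congr 1
    ring
  · intro K hK
    by_cases hK' : K.card = p
    · rw [smul_mul_smul_comm, formBasis_mul_eq_zero e (by omega) hK, smul_zero]
    · simp [hβ K hK']

lemma sum_compl {ν G : Type*} [Fintype ν] [DecidableEq ν] [AddCommMonoid G] (f : Finset ν → G) :
    ∑ J, f Jᶜ = ∑ J, f J :=
  Equiv.sum_comp (compl_involutive (α := Finset ν)).toPerm f

/-- The difference of the norms of the components of a bi-form of middle degree. -/
theorem normSq_component_sub {k : ℕ} (e : OrthonormalBasis (Fin (4 * k)) ℝ T)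
    (s : OrthonormalBasis (Fin (4 * k)) ℝ W) (q : Finset (Fin (4 * k)) → Forms T)
    (hq : ∀ J, J.card ≠ 2 * k → q J = 0)
    (hq' : ∀ J I : Finset (Fin (4 * k)), I.card ≠ 2 * k → (formBasis e).repr (q J) I = 0)
    (δ : ℤˣ) :
    ∑ J, q J * q J + ((δ : ℤ) : ℝ) • ∑ J, complSign s J • (q J * q Jᶜ) =
      (2 * (normSq e s (component e s 1 δ (∑ J, q J ⊗ₜ[ℝ] formBasis s J))
        - normSq e s (component e s (-1) δ (∑ J, q J ⊗ₜ[ℝ] formBasis s J)))) •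
        volumeElement e := by
  set x : Finset (Fin (4 * k)) → Finset (Fin (4 * k)) → ℝ := fun I J => (formBasis e).repr (q J) I
    with hx
  have hB : ∀ I J, ((formBasis e).tensorProduct (formBasis s)).repr
      (∑ J, q J ⊗ₜ[ℝ] formBasis s J) (I, J) = x I J := by
    intro I J
    simp only [map_sum, Finsupp.coe_finsetSum, Finset.sum_apply,
      Basis.tensorProduct_repr_tmul_apply, Basis.repr_self, smul_eq_mul]
    rw [Fintype.sum_eq_single J fun K hK => by simp [hK]]
    simp [x]
  have hd : ∀ J, complSign s J ^ 2 = 1 := fun J => (formBasis_mul_compl s J).2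
  -- The sign symmetry under complement needs even degree; elsewhere the coefficient `x I J`
  -- vanishes.
  have hcx : ∀ I J, complSign e Iᶜ * x I J = complSign e I * x I J := fun I J => by
    by_cases h : I.card = 2 * k
    · rw [complSign_compl e h]
    · simp [x, hq' J I h]
  have hdx : ∀ I J, complSign s Jᶜ * x I J = complSign s J * x I J := fun I J => by
    by_cases h : J.card = 2 * k
    · rw [complSign_compl s h]
    · simp [x, hq J h]
  have hδ : (((δ : ℤ) : ℝ)) ^ 2 = 1 := by
    norm_cast
    simp [sq]
  -- Summed over all `I` and `J`, `u` gives `⟨B, (* ⊗ 1) B⟩` and `v` gives `⟨B, (* ⊗ *) B⟩`.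
  set u : Finset (Fin (4 * k)) → Finset (Fin (4 * k)) → ℝ := fun I J =>
    complSign e I * x I J * x Iᶜ J with hu
  set v : Finset (Fin (4 * k)) → Finset (Fin (4 * k)) → ℝ := fun I J =>
    complSign e I * complSign s J * x I J * x Iᶜ Jᶜ with hv
  -- The two components have coefficients `¼ (a ± b)`, so the squares differ by `¼ a b`. The terms
  -- at `Jᶜ` merge with those at `J` after summation, which turns `¼` into `½`.
  have pointwise : ∀ I J,
      (((formBasis e).tensorProduct (formBasis s)).repr
        (component e s 1 δ (∑ J, q J ⊗ₜ[ℝ] formBasis s J)) (I, J)) ^ 2 -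
      (((formBasis e).tensorProduct (formBasis s)).repr
        (component e s (-1) δ (∑ J, q J ⊗ₜ[ℝ] formBasis s J)) (I, J)) ^ 2 =
      1 / 4 * (u I J + u I Jᶜ + ((δ : ℤ) : ℝ) * (v I J + v I Jᶜ)) := by
    intro I J
    simp only [repr_component, hB, hu, hv, compl_compl]
    have h1 := hcx I J
    have h2 := hcx I Jᶜ
    have h3 := hdx I J
    have h4 := hd Jᶜ
    push_cast
    linear_combination (1 / 4) * (x Iᶜ J + δ * complSign s Jᶜ * x Iᶜ Jᶜ) *
      (h1 + δ * complSign s Jᶜ * h2)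
      + (1 / 4) * δ * complSign e I * x Iᶜ Jᶜ * h3
      + (1 / 4) * complSign e I * x I Jᶜ * x Iᶜ Jᶜ * (h4 + complSign s Jᶜ ^ 2 * hδ)
  have hmul : ∀ J K, q J * q K =
      (∑ I, complSign e I * x I J * x Iᶜ K) • volumeElement e := fun J K =>
    mul_eq_smul_volumeElement e (p := 2 * k) (by omega) (hq' J) (hq' K)
  have hsum : 2 * (normSq e s (component e s 1 δ (∑ J, q J ⊗ₜ[ℝ] formBasis s J))
        - normSq e s (component e s (-1) δ (∑ J, q J ⊗ₜ[ℝ] formBasis s J))) =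
      ∑ I, ∑ J, u I J + ((δ : ℤ) : ℝ) * ∑ I, ∑ J, v I J := by
    rw [normSq, normSq, ← Finset.sum_sub_distrib, Fintype.sum_prod_type]
    simp only [pointwise, ← Finset.mul_sum, Finset.sum_add_distrib]
    have hu' : ∀ I, ∑ J, u I Jᶜ = ∑ J, u I J := fun I => sum_compl (u I)
    have hv' : ∀ I, ∑ J, v I Jᶜ = ∑ J, v I J := fun I => sum_compl (v I)
    simp only [hu', hv']
    ring
  have hA : ∑ J, q J * q J = (∑ I, ∑ J, u I J) • volumeElement e := by
    rw [Finset.sum_comm, Finset.sum_smul]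
    exact Finset.sum_congr rfl fun J _ => hmul J J
  have hB : ∑ J, complSign s J • (q J * q Jᶜ) = (∑ I, ∑ J, v I J) • volumeElement e := by
    rw [Finset.sum_comm, Finset.sum_smul]
    refine Finset.sum_congr rfl fun J _ => ?_
    rw [hmul, smul_smul, Finset.mul_sum]
    congr 1
    exact Finset.sum_congr rfl fun I _ => by simp only [hv]; ring
  rw [hsum, hA, hB, smul_smul, ← add_smul]

lemma repr_eq_zero_of_mem_exteriorPower (e : OrthonormalBasis (Fin n) ℝ T) {p : ℕ} {α : Forms T}
    (hα : α ∈ ⋀[ℝ]^p (Dual ℝ T)) {I : Finset (Fin n)} (hI : I.card ≠ p) :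
    (formBasis e).repr α I = 0 := by
  have h := congrArg (Subtype.val) ((e.toBasis.dualBasis.exteriorPower p).sum_repr ⟨α, hα⟩)
  simp only [AddSubmonoidClass.coe_finsetSum, SetLike.val_smul,
    ← ExteriorAlgebra.basis_eq_coe_basis] at h
  rw [← h]
  simp only [map_sum, map_smul, Finsupp.coe_finsetSum, Finset.sum_apply, Finsupp.smul_apply]
  refine Finset.sum_eq_zero fun J _ => ?_
  change _ • (formBasis e).repr (formBasis e J) I = 0
  rw [Basis.repr_self, Finsupp.single_apply, if_neg, smul_zero]
  rintro rfl
  exact hI J.2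

end Hodge

/-! ### Pontryagin and Euler forms in terms of the coefficients of `Rᵏ` -/

section ChernWeil

variable {T : Type*} [NormedAddCommGroup T] [InnerProductSpace ℝ T]
  {W : Type*} [NormedAddCommGroup W] [InnerProductSpace ℝ W] {n m k : ℕ}

lemma curvatureBiForm_eq (R : T → T → W → W) (e : OrthonormalBasis (Fin n) ℝ T)
    (s : OrthonormalBasis (Fin m) ℝ W) :
    curvatureBiForm R e s = (1 / 2 : ℝ) •
      ∑ a, ∑ b, curvatureMatrix R e s a b ⊗ₜ[ℝ] (coframe s a * coframe s b) := by
  have hinner : ∀ i j a b, (inner ℝ (R (e i) (e j) (s b)) (s a) : ℝ) =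
      s.toBasis.coord a (R (e i) (e j) (s b)) := fun i j a b => by
    rw [real_inner_comm, ← s.repr_apply_apply]
    rfl
  simp only [curvatureBiForm, curvatureMatrix, hinner, TensorProduct.smul_tmul',
    TensorProduct.sum_tmul, Finset.smul_sum, smul_smul]
  rw [Finset.sum_congr rfl fun i _ => Finset.sum_comm, Finset.sum_comm]
  refine Finset.sum_congr rfl fun a _ => ?_
  rw [Finset.sum_congr rfl fun i _ => Finset.sum_comm, Finset.sum_comm]
  refine Finset.sum_congr rfl fun b _ => ?_
  refine Finset.sum_congr rfl fun i _ => Finset.sum_congr rfl fun j _ => ?_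
  congr 2
  ring

lemma curvatureMatrix_mem_center (R : T → T → W → W) (e : OrthonormalBasis (Fin n) ℝ T)
    (s : OrthonormalBasis (Fin m) ℝ W) (a b : Fin m) :
    curvatureMatrix R e s a b ∈ Subalgebra.center ℝ (Forms T) :=
  Subalgebra.smul_mem _ (Subalgebra.sum_mem _ fun _ _ => Subalgebra.sum_mem _ fun _ _ =>
    Subalgebra.smul_mem _ (ι_mul_ι_mem_center _ _) _) _

lemma curvatureMatrix_mem_exteriorPower (R : T → T → W → W) (e : OrthonormalBasis (Fin n) ℝ T)
    (s : OrthonormalBasis (Fin m) ℝ W) (a b : Fin m) :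
    curvatureMatrix R e s a b ∈ ⋀[ℝ]^2 (Dual ℝ T) := by
  refine Submodule.smul_mem _ _ (Submodule.sum_mem _ fun _ _ => Submodule.sum_mem _ fun _ _ =>
    Submodule.smul_mem _ _ ?_)
  change _ ∈ LinearMap.range (ExteriorAlgebra.ι ℝ) ^ 2
  rw [pow_two]
  exact Submodule.mul_mem_mul ⟨_, rfl⟩ ⟨_, rfl⟩

/-- The curvature matrix, with entries in the commutative algebra of central forms. -/
def centralCurvatureMatrix (R : T → T → W → W) (e : OrthonormalBasis (Fin n) ℝ T)
    (s : OrthonormalBasis (Fin m) ℝ W) :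
    Matrix (Fin m) (Fin m) (Subalgebra.center ℝ (Forms T)) :=
  fun a b => ⟨curvatureMatrix R e s a b, curvatureMatrix_mem_center R e s a b⟩

/-- The entries are combinations of products of two one-forms, which have square zero, so they lie
in the nilradical of the center. This is the nilpotency that `pfSum_sq` asks for. -/
lemma isNilpotent_centralCurvatureMatrix (R : T → T → W → W) (e : OrthonormalBasis (Fin n) ℝ T)
    (s : OrthonormalBasis (Fin m) ℝ W) (a b : Fin m) :
    IsNilpotent (centralCurvatureMatrix R e s a b) := by
  let y : Fin n → Fin n → Subalgebra.center ℝ (Forms T) := fun i j =>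
    ⟨coframe e i * coframe e j, ι_mul_ι_mem_center _ _⟩
  have hy : ∀ i j, y i j ∈ nilradical (Subalgebra.center ℝ (Forms T)) := fun i j =>
    mem_nilradical.2 ⟨2, Subtype.ext (ι_mul_ι_sq _ _)⟩
  have h : centralCurvatureMatrix R e s a b = (1 / 2 : ℝ) •
      ∑ i, ∑ j, s.toBasis.coord a (R (e i) (e j) (s b)) • y i j := by
    refine Subtype.ext ?_
    simp [centralCurvatureMatrix, curvatureMatrix, y]
  rw [h, ← mem_nilradical]
  refine Submodule.smul_of_tower_mem _ _ (Ideal.sum_mem _ fun i _ => Ideal.sum_mem _ fun j _ =>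
    Submodule.smul_of_tower_mem _ _ (hy i j))

lemma curvatureMatrix_skew {R : T → T → W → W} {e : OrthonormalBasis (Fin n) ℝ T}
    {s : OrthonormalBasis (Fin m) ℝ W}
    (hR : ∀ i j a b, inner ℝ (R (e i) (e j) (s a)) (s b) = - inner ℝ (R (e i) (e j) (s b)) (s a))
    (a b : Fin m) : curvatureMatrix R e s b a = - curvatureMatrix R e s a b := by
  have : ∀ i j, s.toBasis.coord b (R (e i) (e j) (s a)) =
      - s.toBasis.coord a (R (e i) (e j) (s b)) := fun i j => by
    have h : ∀ a b, s.toBasis.coord a (R (e i) (e j) (s b)) =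
        inner ℝ (R (e i) (e j) (s b)) (s a) := fun a b => by
      rw [real_inner_comm, ← s.repr_apply_apply]
      rfl
    rw [h, h, hR]
  simp only [curvatureMatrix, this, neg_smul, Finset.sum_neg_distrib, smul_neg]

/-- The coefficient of `s^J` in `Rᵏ`. -/
def powCoeff (k : ℕ) (R : T → T → W → W) (e : OrthonormalBasis (Fin n) ℝ T)
    (s : OrthonormalBasis (Fin m) ℝ W) (J : Finset (Fin m)) : Forms T :=
  if h : J.card = 2 * k then
    (1 / 2 : ℝ) ^ k • pfSum ((curvatureMatrix R e s).submatrix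
      (Set.powersetCard.ofFinEmbEquiv.symm ⟨J, h⟩) (Set.powersetCard.ofFinEmbEquiv.symm ⟨J, h⟩))
  else 0

lemma powCoeff_of_card_ne (R : T → T → W → W) (e : OrthonormalBasis (Fin n) ℝ T)
    (s : OrthonormalBasis (Fin m) ℝ W) {J : Finset (Fin m)} (h : J.card ≠ 2 * k) :
    powCoeff k R e s J = 0 :=
  dif_neg h

lemma powCoeff_powersetCard (R : T → T → W → W) (e : OrthonormalBasis (Fin n) ℝ T)
    (s : OrthonormalBasis (Fin m) ℝ W) (J : Set.powersetCard (Fin m) (2 * k)) :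
    powCoeff k R e s J = (1 / 2 : ℝ) ^ k • pfSum ((curvatureMatrix R e s).submatrix
      (Set.powersetCard.ofFinEmbEquiv.symm J) (Set.powersetCard.ofFinEmbEquiv.symm J)) :=
  dif_pos J.2

lemma sum_powersetCard_eq_sum {ν G : Type*} [Fintype ν] [AddCommMonoid G] {q : ℕ}
    (f : Finset ν → G) (hf : ∀ J : Finset ν, J.card ≠ q → f J = 0) :
    ∑ J : Set.powersetCard ν q, f J = ∑ J, f J :=
  Fintype.sum_of_injective (fun J : Set.powersetCard ν q => (J : Finset ν))
    Subtype.val_injective _ _ (fun J hJ => hf J fun h => hJ ⟨⟨J, h⟩, rfl⟩) fun _ => rfl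

lemma curvatureBiForm_pow (k : ℕ) (R : T → T → W → W) (e : OrthonormalBasis (Fin n) ℝ T)
    (s : OrthonormalBasis (Fin m) ℝ W) :
    curvatureBiForm R e s ^ k = ∑ J, powCoeff k R e s J ⊗ₜ[ℝ] formBasis s J := by
  rw [← sum_powersetCard_eq_sum (q := 2 * k) _ fun J hJ => by
      rw [powCoeff_of_card_ne R e s hJ, TensorProduct.zero_tmul],
    curvatureBiForm_eq, smul_pow, sum_tmul_pow, Finset.smul_sum]
  refine Finset.sum_congr rfl fun J _ => ?_
  rw [powCoeff_powersetCard, TensorProduct.smul_tmul']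

lemma repr_powCoeff_of_card_ne (R : T → T → W → W) (e : OrthonormalBasis (Fin n) ℝ T)
    (s : OrthonormalBasis (Fin m) ℝ W) (J : Finset (Fin m)) {I : Finset (Fin n)}
    (hI : I.card ≠ 2 * k) : (formBasis e).repr (powCoeff k R e s J) I = 0 := by
  by_cases hJ : J.card = 2 * k
  swap
  · simp [powCoeff_of_card_ne R e s hJ]
  refine repr_eq_zero_of_mem_exteriorPower e ?_ hI
  rw [powCoeff, dif_pos hJ]
  refine Submodule.smul_mem _ _ (Submodule.sum_mem _ fun σ _ => Submodule.smul_mem _ _ ?_)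
  have := SetLike.list_prod_ofFn_mem_graded (A := fun p : ℕ => ⋀[ℝ]^p (Dual ℝ T))
    (fun _ : Fin k => 2) _ fun i : Fin k => curvatureMatrix_mem_exteriorPower R e s
      (Set.powersetCard.ofFinEmbEquiv.symm ⟨J, hJ⟩ (σ ⟨2 * i, by omega⟩))
      (Set.powersetCard.ofFinEmbEquiv.symm ⟨J, hJ⟩ (σ ⟨2 * i + 1, by omega⟩))
  simpa [mul_comm] using this

/-- Each inner sum is a principal minor `det Ω_J`. As `pfSum² = (2^k k!)² det` and the coefficient
of `s^J` is `2^(-k) pfSum`, its square is `(k!)² det Ω_J`. -/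
lemma pontryaginForm_eq {R : T → T → W → W} {e : OrthonormalBasis (Fin n) ℝ T}
    {s : OrthonormalBasis (Fin m) ℝ W}
    (hR : ∀ i j a b, inner ℝ (R (e i) (e j) (s a)) (s b) = - inner ℝ (R (e i) (e j) (s b)) (s a)) :
    pontryaginForm k R e s = (1 / ((2 * Real.pi) ^ (2 * k) * (k.factorial : ℝ) ^ 2)) •
      ∑ J, powCoeff k R e s J * powCoeff k R e s J := by
  rw [← sum_powersetCard_eq_sum (q := 2 * k) _ fun J hJ => by
    rw [powCoeff_of_card_ne R e s hJ, zero_mul]]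
  simp only [pontryaginForm]
  rw [one_div, one_div, mul_inv, mul_smul]
  congr 1
  rw [Finset.smul_sum]
  refine Finset.sum_congr rfl fun J _ => ?_
  set f := Set.powersetCard.ofFinEmbEquiv.symm J
  set N := (centralCurvatureMatrix R e s).submatrix f f
  have hskew : N.transpose = -N := by
    ext a b
    exact curvatureMatrix_skew hR _ _
  have hsq := pfSum_sq hskew fun a b => isNilpotent_centralCurvatureMatrix R e s (f a) (f b)
  have hdet : ∑ σ : Equiv.Perm (Fin (2 * k)), ((Equiv.Perm.sign σ : ℤ) : ℝ) •
      (List.ofFn fun i => curvatureMatrix R e s (f i) (f (σ i))).prod =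
      (Subalgebra.center ℝ (Forms T)).val N.det := by
    -- `Matrix.det_apply'` permutes the row index, the Pontryagin form the column index.
    rw [← Matrix.det_transpose, Matrix.det_apply', map_sum]
    refine Finset.sum_congr rfl fun σ _ => ?_
    rw [Int.cast_smul_eq_zsmul, zsmul_eq_mul, map_mul, map_intCast, ← List.prod_ofFn,
      map_list_prod, List.map_ofFn]
    rfl
  have hpf : pfSum ((curvatureMatrix R e s).submatrix f f) =
      (Subalgebra.center ℝ (Forms T)).val (pfSum N) := by
    rw [map_pfSum]
    rfl
  have hsq' : pfSum ((curvatureMatrix R e s).submatrix f f) ^ 2 =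
      ((2 ^ k * k.factorial) ^ 2 : ℝ) • (Subalgebra.center ℝ (Forms T)).val N.det := by
    rw [hpf, ← map_pow]
    refine (congrArg (Subalgebra.center ℝ (Forms T)).val hsq).trans ?_
    rw [map_mul, map_pow, AlgHom.commutes, ← map_pow, ← Algebra.smul_def]
  rw [← hdet] at hsq'
  rw [powCoeff_powersetCard, smul_mul_smul_comm, ← sq (pfSum _), hsq', smul_smul, smul_smul]
  have : ((k.factorial : ℝ) ^ 2)⁻¹ * ((1 / 2 : ℝ) ^ k * (1 / 2) ^ k) *
      (2 ^ k * (k.factorial : ℝ)) ^ 2 = 1 := by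
    have : (k.factorial : ℝ) ≠ 0 := by positivity
    rw [one_div, inv_pow]
    field_simp
  rw [this, one_smul]

/-- The top power `R ^ (2k)` is computed twice: directly as a Pfaffian, and as the square of `R ^
k`, where only complementary pairs `J`, `Jᶜ` survive. -/
lemma pfSum_curvatureMatrix_eq (R : T → T → W → W) (e : OrthonormalBasis (Fin n) ℝ T)
    (s : OrthonormalBasis (Fin (4 * k)) ℝ W) (h : 2 * (2 * k) = 4 * k) :
    pfSum ((curvatureMatrix R e s).submatrix (Fin.cast h) (Fin.cast h)) =
      (2 : ℝ) ^ (2 * k) •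
        ∑ J, complSign s J • (powCoeff k R e s J * powCoeff k R e s Jᶜ) := by
  have h1 := sum_tmul_pow_top (curvatureMatrix R e s) s h
  have h2 : ∑ a, ∑ b, curvatureMatrix R e s a b ⊗ₜ[ℝ] (coframe s a * coframe s b) =
      (2 : ℝ) • curvatureBiForm R e s := by
    rw [curvatureBiForm_eq, smul_smul]
    norm_num
  have h4 : curvatureBiForm R e s ^ (2 * k) = (∑ J, powCoeff k R e s J ⊗ₜ[ℝ] formBasis s J) *
      ∑ J, powCoeff k R e s J ⊗ₜ[ℝ] formBasis s J := by
    rw [two_mul, pow_add, curvatureBiForm_pow]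
  rw [h2, smul_pow, h4, Finset.sum_mul_sum] at h1
  -- Extract the coefficient of the fiber volume element from the second tensor factor.
  have h3 := congrArg (TensorProduct.rid ℝ (Forms T) ∘
    (TensorProduct.map LinearMap.id ((formBasis s).coord Finset.univ))) h1
  simp only [Function.comp_apply, TensorProduct.map_tmul, LinearMap.id_apply,
    TensorProduct.rid_tmul, map_smul, map_sum, Algebra.TensorProduct.tmul_mul_tmul] at h3
  have hvol : (formBasis s).coord Finset.univ (volumeElement s) = 1 := by simp [volumeElement]
  rw [hvol, one_smul] at h3
  rw [← h3]
  congr 1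
  refine Finset.sum_congr rfl fun J _ => ?_
  rw [Fintype.sum_eq_single Jᶜ]
  · rfl
  · intro K hK
    by_cases hJ : J.card = 2 * k
    swap
    · simp [powCoeff_of_card_ne R e s hJ]
    by_cases hK' : K.card = 2 * k
    swap
    · simp [powCoeff_of_card_ne R e s hK']
    rw [formBasis_mul_eq_zero s (by omega) hK, map_zero, zero_smul]

/-- The binomial coefficient enters here: `(2k)! / (k!)²` converts the normalization of the Pfaffian
of `Ω` into that of the products `q_J ∧ q_{Jᶜ}`. -/
lemma eulerForm_eq (R : T → T → W → W) (e : OrthonormalBasis (Fin n) ℝ T)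
    (s : OrthonormalBasis (Fin (4 * k)) ℝ W) :
    ((2 * k).choose k : ℝ) • eulerForm k R e s =
      (1 / ((2 * Real.pi) ^ (2 * k) * (k.factorial : ℝ) ^ 2)) •
        ∑ J, complSign s J • (powCoeff k R e s J * powCoeff k R e s Jᶜ) := by
  have h : 2 * (2 * k) = 4 * k := by ring
  have key : ∑ σ : Equiv.Perm (Fin (4 * k)), ((Equiv.Perm.sign σ : ℤ) : ℝ) •
      (List.ofFn fun i : Fin (2 * k) => curvatureMatrix R e s
        (σ ⟨2 * i, by omega⟩) (σ ⟨2 * i + 1, by omega⟩)).prod =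
      pfSum ((curvatureMatrix R e s).submatrix (Fin.cast h) (Fin.cast h)) := by
    rw [pfSum, ← (finCongr h).permCongr.sum_comp]
    refine Finset.sum_congr rfl fun σ _ => ?_
    rw [Equiv.Perm.sign_permCongr]
    rfl
  simp only [eulerForm]
  rw [key, pfSum_curvatureMatrix_eq R e s h, smul_smul, smul_smul]
  congr 1
  have hc : ((2 * k).choose k : ℝ) * (k.factorial * k.factorial) = (2 * k).factorial := by
    have := Nat.choose_mul_factorial_mul_factorial (n := 2 * k) (k := k) (by omega)
    rw [show 2 * k - k = k by omega] at this
    rw [← mul_assoc]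
    exact_mod_cast this
  have h1 : (k.factorial : ℝ) ≠ 0 := by positivity
  have h2 : ((2 * k).factorial : ℝ) ≠ 0 := by positivity
  have h3 := Real.pi_ne_zero
  field_simp
  linear_combination hc

/-- In `normSq_component_sub` the sign `δ` stands at the Euler term. Multiplying by `δ` moves it to
the Pontryagin term, since `δ² = 1`, so both identities are covered. -/
theorem choose_smul_eulerForm_add_smul_pontryaginForm {k : ℕ} {R : T → T → W → W}
    {e : OrthonormalBasis (Fin (4 * k)) ℝ T} {s : OrthonormalBasis (Fin (4 * k)) ℝ W}
    (hR : ∀ i j a b, inner ℝ (R (e i) (e j) (s a)) (s b) = - inner ℝ (R (e i) (e j) (s b)) (s a))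
    (δ : ℤˣ) :
    ((2 * k).choose k : ℝ) • eulerForm k R e s + ((δ : ℤ) : ℝ) • pontryaginForm k R e s =
      (2 / ((2 * Real.pi) ^ (2 * k) * (k.factorial : ℝ) ^ 2) * (((δ : ℤ) : ℝ) *
        (normSq e s (powComponent k R e s 1 δ) - normSq e s (powComponent k R e s (-1) δ)))) •
          volumeElement e := by
  have h := normSq_component_sub e s (powCoeff k R e s)
    (fun _ hJ => powCoeff_of_card_ne R e s hJ)
    (fun J _ hI => repr_powCoeff_of_card_ne R e s J hI) δ
  rw [← curvatureBiForm_pow] at h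
  have hδ : ((δ : ℤ) : ℝ) * ((δ : ℤ) : ℝ) = 1 := by
    norm_cast
    simp
  rw [eulerForm_eq, pontryaginForm_eq hR]
  set c : ℝ := 1 / ((2 * Real.pi) ^ (2 * k) * (k.factorial : ℝ) ^ 2)
  have hc : 2 / ((2 * Real.pi) ^ (2 * k) * (k.factorial : ℝ) ^ 2) = c * 2 := by
    simp only [c]
    ring
  have h' := congrArg (fun α => (c * ((δ : ℤ) : ℝ)) • α) h
  simp only [smul_add, smul_smul, mul_assoc, hδ, mul_one] at h'
  rw [smul_smul, mul_comm _ c, add_comm, h', hc]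
  congr 1
  simp only [powComponent]
  ring

end ChernWeil

/-! ### Exchange of the two tensor factors -/

section PairSymmetry

variable {T : Type*} [NormedAddCommGroup T] [InnerProductSpace ℝ T] {n : ℕ}

lemma comm_component (e : OrthonormalBasis (Fin n) ℝ T) (ε δ : ℤˣ) (B : BiForms T T) :
    Algebra.TensorProduct.comm ℝ (Forms T) (Forms T) (component e e ε δ B) =
      component e e δ ε (Algebra.TensorProduct.comm ℝ (Forms T) (Forms T) B) := by
  induction B using TensorProduct.induction_on with
  | zero => simp [component]
  | tmul α β => simp [component]
  | add B C hB hC =>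
    simp only [component] at hB hC ⊢
    simp only [map_add, hB, hC]

/-- The exchange of factors is an algebra automorphism. It fixes `R` by the symmetry in pairs, hence
fixes `R ^ k`, and it carries the component `(ε, δ)` to `(δ, ε)`. -/
theorem powComponent_eq_zero_iff_of_pairSymmetric {k : ℕ} {R : T → T → T → T}
    {e : OrthonormalBasis (Fin n) ℝ T}
    (hR : ∀ i j a b, inner ℝ (R (e i) (e j) (e b)) (e a) = inner ℝ (R (e a) (e b) (e j)) (e i))
    (ε δ : ℤˣ) :
    powComponent k R e e ε δ = 0 ↔ powComponent k R e e δ ε = 0 := by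
  have hcomm : Algebra.TensorProduct.comm ℝ (Forms T) (Forms T) (curvatureBiForm R e e) =
      curvatureBiForm R e e := by
    simp only [curvatureBiForm, map_smul, map_sum, Algebra.TensorProduct.comm_tmul]
    congr 1
    simp only [← Fintype.sum_prod_type']
    refine Fintype.sum_equiv ⟨fun p => (p.2.2.1, p.2.2.2, p.1, p.2.1),
      fun p => (p.2.2.1, p.2.2.2, p.1, p.2.1), fun _ => rfl, fun _ => rfl⟩ _ _ fun p => ?_
    simp only [Equiv.coe_fn_mk]
    rw [hR]
  rw [powComponent, powComponent,
    ← EmbeddingLike.map_eq_zero_iff (f := Algebra.TensorProduct.comm ℝ (Forms T) (Forms T)),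
    comm_component, map_pow,
    hcomm]

end PairSymmetry

/-! ### Smoothness of local extensions and covariant derivatives -/

section Smoothness

variable {E : Type*} [NormedAddCommGroup E] [NormedSpace ℝ E]
  {M : Type*} [TopologicalSpace M] [ChartedSpace E M]

/-- The extension is constant in the trivialization. Smoothness on an open set, not merely at `x`,
is needed because the curvature differentiates twice. -/
lemma contMDiffOn_extend_baseSet {F : Type*} [NormedAddCommGroup F] [NormedSpace ℝ F]
    {V : M → Type*} [TopologicalSpace (TotalSpace F V)]
    [∀ x, AddCommGroup (V x)] [∀ x, Module ℝ (V x)] [∀ x, TopologicalSpace (V x)]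
    [FiberBundle F V] [VectorBundle ℝ F V] [ContMDiffVectorBundle ∞ F V 𝓘(ℝ, E)]
    {x : M} (w : V x) :
    CMDiff[(trivializationAt F V x).baseSet] ∞ (T% (FiberBundle.extend F w)) := by
  set t := trivializationAt F V x
  intro y hy
  rw [t.contMDiffWithinAt_section _ hy]
  have h : CMDiff[t.baseSet] ∞ (fun _ : M => (t ⟨x, w⟩).2) := contMDiffOn_const
  exact h.congr (fun z hz => by simp [FiberBundle.extend, t, hz]) y hy

variable [FiniteDimensional ℝ E] [IsManifold 𝓘(ℝ, E) ∞ M]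

/-- The covariant derivative of a section that is smooth on an open set is smooth there. -/
lemma contMDiffOn_cov [T2Space M] {F : Type*} [NormedAddCommGroup F] [NormedSpace ℝ F]
    {V : M → Type*} [TopologicalSpace (TotalSpace F V)]
    [∀ x, AddCommGroup (V x)] [∀ x, Module ℝ (V x)] [∀ x, TopologicalSpace (V x)]
    [∀ x, IsTopologicalAddGroup (V x)] [∀ x, ContinuousSMul ℝ (V x)]
    [FiberBundle F V] [VectorBundle ℝ F V] [ContMDiffVectorBundle ∞ F V 𝓘(ℝ, E)]
    {D : CovariantDerivative 𝓘(ℝ, E) F V} (hD : D.ContMDiffCovariantDerivative ∞)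
    {u : Set M} (hu : IsOpen u) {σ : ∀ y, V y} (hσ : CMDiff[u] ∞ (T% σ)) :
    ContMDiffOn 𝓘(ℝ, E) (𝓘(ℝ, E).prod 𝓘(ℝ, E →L[ℝ] F)) ∞
      (fun y => (⟨y, D σ y⟩ :
        TotalSpace (E →L[ℝ] F) fun y => TangentSpace 𝓘(ℝ, E) y →L[ℝ] V y)) u := by
  intro y hy
  -- The smoothness of `D` is applied to a global section, so `σ` is cut off by a bump function.
  -- Near `y` this changes neither `σ` nor, by locality, `D σ`.
  obtain ⟨f, -, hf⟩ := (SmoothBumpFunction.nhds_basis_tsupport (I := 𝓘(ℝ, E)) y).mem_iff.1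
    (hu.mem_nhds hy)
  have hfσ : CMDiff ∞ (T% ((f : M → ℝ) • σ)) :=
    ContMDiffOn.smul_section_of_tsupport f.contMDiff.contMDiffOn hu hf hσ
  have hcov := hD.contMDiff.contMDiff (σ := (f : M → ℝ) • σ)
    (by simpa using hfσ.contMDiffOn)
  refine ((hcov.contMDiffAt Filter.univ_mem).congr_of_eventuallyEq ?_).contMDiffWithinAt
  filter_upwards [f.eventuallyEq_one.eventuallyEq_nhds, hu.mem_nhds hy] with z hz hzu
  refine congrArg (TotalSpace.mk z) ?_
  refine D.isCovariantDerivativeOn.congr_of_eventuallyEq (s := Set.univ)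
    ((hσ.contMDiffAt (hu.mem_nhds hzu)).mdifferentiableAt (by simp))
    ((hfσ z).mdifferentiableAt (by simp)) Filter.univ_mem ?_
  filter_upwards [hz] with a ha
  simp [ha]

/-- `D_Y σ` is smooth on an open set where `Y` and `σ` are. -/
lemma contMDiffOn_cov_apply [T2Space M] {F : Type*} [NormedAddCommGroup F] [NormedSpace ℝ F]
    {V : M → Type*} [TopologicalSpace (TotalSpace F V)]
    [∀ x, AddCommGroup (V x)] [∀ x, Module ℝ (V x)] [∀ x, TopologicalSpace (V x)]
    [∀ x, IsTopologicalAddGroup (V x)] [∀ x, ContinuousSMul ℝ (V x)]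
    [FiberBundle F V] [VectorBundle ℝ F V] [ContMDiffVectorBundle ∞ F V 𝓘(ℝ, E)]
    {D : CovariantDerivative 𝓘(ℝ, E) F V} (hD : D.ContMDiffCovariantDerivative ∞)
    {u : Set M} (hu : IsOpen u) {σ : ∀ y, V y} (hσ : CMDiff[u] ∞ (T% σ))
    {Y : ∀ y : M, TangentSpace 𝓘(ℝ, E) y} (hY : CMDiff[u] ∞ (T% Y)) :
    CMDiff[u] ∞ (T% (fun y => D σ y (Y y))) :=
  (contMDiffOn_cov hD hu hσ).clm_bundle_apply hY

end Smoothness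

/-! ### The Lie bracket as a commutator of derivations -/

section LieDerivative

open VectorField

variable {E : Type*} [NormedAddCommGroup E] [NormedSpace ℝ E] [FiniteDimensional ℝ E]
  {M : Type*} [TopologicalSpace M] [ChartedSpace E M] [IsManifold 𝓘(ℝ, E) ∞ M]

lemma mdifferentiableAt_mlieBracket {x : M} {X Y : ∀ y : M, TangentSpace 𝓘(ℝ, E) y}
    (hX : CMDiffAt ∞ (T% X) x) (hY : CMDiffAt ∞ (T% Y) x) :
    MDiffAt (T% (mlieBracket 𝓘(ℝ, E) X Y)) x := by
  have : IsManifold 𝓘(ℝ, E) (minSmoothness ℝ 2) M := by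
    rw [minSmoothness_of_isRCLikeNormedField]
    infer_instance
  have : IsManifold 𝓘(ℝ, E) ((2 : ℕ∞) + 1) M := IsManifold.of_le (n := ∞) (by norm_cast)
  exact (ContMDiffAt.mlieBracket_vectorField (m := 1) (n := 2)
    (hX.of_le (by norm_cast)) (hY.of_le (by norm_cast))
    (by rw [minSmoothness_of_isRCLikeNormedField]; norm_num)).mdifferentiableAt (by simp)

lemma jacobi_mlieBracket {x : M} {X Y Z : ∀ y : M, TangentSpace 𝓘(ℝ, E) y}
    (hX : CMDiffAt ∞ (T% X) x) (hY : CMDiffAt ∞ (T% Y) x) (hZ : CMDiffAt ∞ (T% Z) x) :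
    mlieBracket 𝓘(ℝ, E) X (mlieBracket 𝓘(ℝ, E) Y Z) x =
      mlieBracket 𝓘(ℝ, E) (mlieBracket 𝓘(ℝ, E) X Y) Z x +
        mlieBracket 𝓘(ℝ, E) Y (mlieBracket 𝓘(ℝ, E) X Z) x := by
  have : IsManifold 𝓘(ℝ, E) (minSmoothness ℝ 3) M := by
    rw [minSmoothness_of_isRCLikeNormedField]
    infer_instance
  have h2 : minSmoothness ℝ 2 ≤ ∞ := by
    rw [minSmoothness_of_isRCLikeNormedField]
    norm_cast
  exact leibniz_identity_mlieBracket_apply (hX.of_le h2) (hY.of_le h2) (hZ.of_le h2)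

/-- `X (Y f) - Y (X f) = [X, Y] f`. -/
lemma mvfderiv_mlieBracket [Nontrivial E] {u : Set M} (hu : IsOpen u) {x : M} (hx : x ∈ u)
    {X Y : ∀ y : M, TangentSpace 𝓘(ℝ, E) y} (hX : CMDiff[u] ∞ (T% X)) (hY : CMDiff[u] ∞ (T% Y))
    {f : M → ℝ} (hf : CMDiff[u] ∞ f) (hXf : MDiffAt (fun y => d% f y (X y)) x)
    (hYf : MDiffAt (fun y => d% f y (Y y)) x) :
    d% (fun y => d% f y (Y y)) x (X x) - d% (fun y => d% f y (X y)) x (Y x) =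
      d% f x (mlieBracket 𝓘(ℝ, E) X Y x) := by
  -- The formula is the coefficient of `Z` in the Jacobi identity for `X`, `Y`, `f Z`. Reading it
  -- off requires `Z x ≠ 0`.
  obtain ⟨z, hz⟩ : ∃ z : TangentSpace 𝓘(ℝ, E) x, z ≠ 0 := exists_ne (0 : E)
  set Z : ∀ y : M, TangentSpace 𝓘(ℝ, E) y := FiberBundle.extend E z
  have hZx : Z x = z := FiberBundle.extend_apply_self E z
  have hu' : u ∩ (trivializationAt E (TangentSpace 𝓘(ℝ, E)) x).baseSet ∈ 𝓝 x :=
    Filter.inter_mem (hu.mem_nhds hx)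
      ((trivializationAt E (TangentSpace 𝓘(ℝ, E)) x).open_baseSet.mem_nhds
      (FiberBundle.mem_baseSet_trivializationAt' x))
  have hZ : CMDiff[(trivializationAt E (TangentSpace 𝓘(ℝ, E)) x).baseSet] ∞ (T% Z) :=
    contMDiffOn_extend_baseSet z
  have cX : CMDiffAt ∞ (T% X) x := hX.contMDiffAt (hu.mem_nhds hx)
  have cY : CMDiffAt ∞ (T% Y) x := hY.contMDiffAt (hu.mem_nhds hx)
  have cZ : CMDiffAt ∞ (T% Z) x := FiberBundle.contMDiffAt_extend _ _ _
  have cf : CMDiffAt ∞ f x := hf.contMDiffAt (hu.mem_nhds hx)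
  -- The Leibniz rule is needed on a neighbourhood, since the result is bracketed once more.
  have key : ∀ W : ∀ y : M, TangentSpace 𝓘(ℝ, E) y,
      mlieBracket 𝓘(ℝ, E) W (f • Z) =ᶠ[𝓝 x]
        (fun y => d% f y (W y)) • Z + f • mlieBracket 𝓘(ℝ, E) W Z := by
    intro W
    filter_upwards [hu'] with y hy
    have h1 : MDiffAt f y :=
      (hf.contMDiffAt (hu.mem_nhds hy.1)).mdifferentiableAt (by simp)
    have h2 : MDiffAt (T% Z) y := (hZ.contMDiffAt
      ((trivializationAt E (TangentSpace 𝓘(ℝ, E)) x).open_baseSet.mem_nhds hy.2)).mdifferentiableAt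
        (by simp)
    rw [mlieBracket_smul_right h1 h2]
    rfl
  have dZ : MDiffAt (T% Z) x := cZ.mdifferentiableAt (by simp)
  have df : MDiffAt f x := cf.mdifferentiableAt (by simp)
  have br : ∀ {W : ∀ y : M, TangentSpace 𝓘(ℝ, E) y}, CMDiffAt ∞ (T% W) x →
      MDiffAt (T% (mlieBracket 𝓘(ℝ, E) W Z)) x := fun hW => mdifferentiableAt_mlieBracket hW cZ
  have expand : ∀ U W : ∀ y : M, TangentSpace 𝓘(ℝ, E) y, CMDiffAt ∞ (T% W) x →
      MDiffAt (fun y => d% f y (W y)) x →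
      mlieBracket 𝓘(ℝ, E) U (mlieBracket 𝓘(ℝ, E) W (f • Z)) x =
        d% (fun y => d% f y (W y)) x (U x) • Z x + d% f x (W x) • mlieBracket 𝓘(ℝ, E) U Z x
         + (d% f x (U x) • mlieBracket 𝓘(ℝ, E) W Z x
            + f x • mlieBracket 𝓘(ℝ, E) U (mlieBracket 𝓘(ℝ, E) W Z) x) := by
    intro U W hW hWf
    rw [(Filter.EventuallyEq.refl _ U).mlieBracket_vectorField_eq (key W)]
    rw [mlieBracket_add_right, mlieBracket_smul_right hWf dZ, mlieBracket_smul_right df (br hW)]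
    · exact hWf.smul_section dZ
    · exact df.smul_section (br hW)
  have J1 := jacobi_mlieBracket cX cY (cf.smul_section cZ)
  have J2 := jacobi_mlieBracket cX cY cZ
  rw [expand X Y cY hYf, expand Y X cX hXf, mlieBracket_smul_right df dZ, J2] at J1
  have : (d% (fun y => d% f y (Y y)) x (X x) - d% (fun y => d% f y (X y)) x (Y x) -
      d% f x (mlieBracket 𝓘(ℝ, E) X Y x)) • Z x = 0 := by
    rw [smul_add] at J1
    rw [sub_smul, sub_smul]
    refine Eq.trans ?_ (sub_eq_zero.2 J1)
    module
  rw [hZx] at this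
  exact sub_eq_zero.1 ((smul_eq_zero.1 this).resolve_right hz)

end LieDerivative

/-! ### Symmetries of the curvature -/

section Curvature

open VectorField

variable {E : Type*} [NormedAddCommGroup E] [NormedSpace ℝ E]
  {M : Type*} [TopologicalSpace M] [ChartedSpace E M] [IsManifold 𝓘(ℝ, E) ∞ M]
  {F : Type*} [NormedAddCommGroup F] [NormedSpace ℝ F]

lemma curvature_swap {V : M → Type*} [TopologicalSpace (TotalSpace F V)]
    [∀ x, AddCommGroup (V x)] [∀ x, Module ℝ (V x)] [∀ x, TopologicalSpace (V x)]
    [∀ x, IsTopologicalAddGroup (V x)] [∀ x, ContinuousSMul ℝ (V x)] [FiberBundle F V]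
    (D : CovariantDerivative 𝓘(ℝ, E) F V) (x : M) (a b : TangentSpace 𝓘(ℝ, E) x) (w : V x) :
    curvature D x a b w = - curvature D x b a w := by
  simp only [curvature]
  rw [mlieBracket_swap_apply, map_neg]
  abel

variable [FiniteDimensional ℝ E]

/-- The curvature of a metric connection has skew-adjoint values. -/
lemma inner_curvature_skew [T2Space M] [Nontrivial E] [FiniteDimensional ℝ F]
    {V : M → Type*} [TopologicalSpace (TotalSpace F V)]
    [∀ x, NormedAddCommGroup (V x)] [∀ x, InnerProductSpace ℝ (V x)]
    [FiberBundle F V] [VectorBundle ℝ F V] [ContMDiffVectorBundle ∞ F V 𝓘(ℝ, E)]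
    [IsContMDiffRiemannianBundle 𝓘(ℝ, E) ∞ F V]
    {D : CovariantDerivative 𝓘(ℝ, E) F V} (hD : D.ContMDiffCovariantDerivative ∞)
    (hm : D.IsMetricCompatible) (x : M) (a b : TangentSpace 𝓘(ℝ, E) x) (w w' : V x) :
    inner ℝ (curvature D x a b w) w' = - inner ℝ (curvature D x a b w') w := by
  simp only [curvature]
  set X : ∀ y : M, TangentSpace 𝓘(ℝ, E) y := FiberBundle.extend E a
  set Y : ∀ y : M, TangentSpace 𝓘(ℝ, E) y := FiberBundle.extend E b
  set s : ∀ y : M, V y := FiberBundle.extend F w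
  set t : ∀ y : M, V y := FiberBundle.extend F w'
  have hsx : s x = w := FiberBundle.extend_apply_self F w
  have htx : t x = w' := FiberBundle.extend_apply_self F w'
  set u : Set M := (trivializationAt E (TangentSpace 𝓘(ℝ, E)) x).baseSet ∩
    (trivializationAt F V x).baseSet
  have hu : IsOpen u := (trivializationAt E (TangentSpace 𝓘(ℝ, E)) x).open_baseSet.inter
    (trivializationAt F V x).open_baseSet
  have hxu : x ∈ u := ⟨FiberBundle.mem_baseSet_trivializationAt' x,
    FiberBundle.mem_baseSet_trivializationAt' x⟩
  have hX : CMDiff[u] ∞ (T% X) := (contMDiffOn_extend_baseSet a).mono Set.inter_subset_left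
  have hY : CMDiff[u] ∞ (T% Y) := (contMDiffOn_extend_baseSet b).mono Set.inter_subset_left
  have hs : CMDiff[u] ∞ (T% s) := (contMDiffOn_extend_baseSet w).mono Set.inter_subset_right
  have ht : CMDiff[u] ∞ (T% t) := (contMDiffOn_extend_baseSet w').mono Set.inter_subset_right
  have at_ : ∀ {σ : ∀ y, V y}, CMDiff[u] ∞ (T% σ) → ∀ y ∈ u, MDiffAt (T% σ) y := fun {σ} h y hy =>
    (h.contMDiffAt (hu.mem_nhds hy)).mdifferentiableAt (by simp)
  -- Skewness is `X (Y f) - Y (X f) = [X, Y] f` for `f = ⟨s, t⟩`, with both sides expanded by metric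
  -- compatibility. The mixed terms `⟨D_X s, D_Y t⟩ + ⟨D_Y s, D_X t⟩` are symmetric in `X`, `Y` and
  -- cancel.
  set f : M → ℝ := fun y => inner ℝ (s y) (t y)
  have hf : CMDiff[u] ∞ f := hs.inner_bundle ht
  have first : ∀ {W : ∀ y : M, TangentSpace 𝓘(ℝ, E) y}, CMDiff[u] ∞ (T% W) →
      (fun y => d% f y (W y)) =ᶠ[𝓝 x]
        fun y => inner ℝ (D s y (W y)) (t y) + inner ℝ (s y) (D t y (W y)) := by
    intro W hW
    filter_upwards [hu.mem_nhds hxu] with y hy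
    exact hm.mvfderiv_inner_eq W (at_ hs y hy) (at_ ht y hy)
  have diff1 : ∀ {W : ∀ y : M, TangentSpace 𝓘(ℝ, E) y}, CMDiff[u] ∞ (T% W) →
      MDiffAt (fun y => inner ℝ (D s y (W y)) (t y)) x ∧
      MDiffAt (fun y => inner ℝ (s y) (D t y (W y))) x := by
    intro W hW
    exact ⟨(at_ (contMDiffOn_cov_apply hD hu hs hW) x hxu).inner_bundle (at_ ht x hxu),
      (at_ hs x hxu).inner_bundle (at_ (contMDiffOn_cov_apply hD hu ht hW) x hxu)⟩
  have diff2 : ∀ {W : ∀ y : M, TangentSpace 𝓘(ℝ, E) y}, CMDiff[u] ∞ (T% W) →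
      MDiffAt (fun y => d% f y (W y)) x := by
    intro W hW
    exact ((diff1 hW).1.add (diff1 hW).2).congr_of_eventuallyEq (first hW)
  have second : ∀ {U W : ∀ y : M, TangentSpace 𝓘(ℝ, E) y}, CMDiff[u] ∞ (T% W) →
      d% (fun y => d% f y (W y)) x (U x) =
        inner ℝ (D (fun y => D s y (W y)) x (U x)) w' + inner ℝ (D s x (W x)) (D t x (U x))
        + (inner ℝ (D s x (U x)) (D t x (W x)) + inner ℝ w (D (fun y => D t y (W y)) x (U x))) := by
    intro U W hW
    have h1 := hm.mvfderiv_inner_eq U (at_ (contMDiffOn_cov_apply hD hu hs hW) x hxu) (at_ ht x hxu)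
    have h2 := hm.mvfderiv_inner_eq U (at_ hs x hxu) (at_ (contMDiffOn_cov_apply hD hu ht hW) x hxu)
    have h3 : d% (fun y => d% f y (W y)) x = d% (fun y => inner ℝ (D s y (W y)) (t y)) x +
        d% (fun y => inner ℝ (s y) (D t y (W y))) x := by
      rw [← mvfderiv_fun_add (diff1 hW).1 (diff1 hW).2]
      have := (first hW).mfderiv_eq (I := 𝓘(ℝ, E)) (I' := 𝓘(ℝ, ℝ))
      ext v
      simp only [mvfderiv]
      exact congrArg (fun L : E →L[ℝ] ℝ => L v) this
    rw [h3, add_apply, h1, h2]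
    simp only [hsx, htx]
  have br := mvfderiv_mlieBracket hu hxu hX hY hf (diff2 hX) (diff2 hY)
  rw [second hX, second hY] at br
  have h4 := hm.mvfderiv_inner_eq (mlieBracket 𝓘(ℝ, E) X Y) (at_ hs x hxu) (at_ ht x hxu)
  simp only [hsx, htx] at h4
  rw [h4] at br
  simp only [inner_sub_left]
  simp only [real_inner_comm w] at br ⊢
  linarith

/-- The first Bianchi identity. -/
lemma curvature_bianchi [T2Space M]
    {D : CovariantDerivative 𝓘(ℝ, E) E (fun x : M => TangentSpace 𝓘(ℝ, E) x)}
    (hD : D.ContMDiffCovariantDerivative ∞) (ht : D.torsion = 0)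
    (x : M) (a b c : TangentSpace 𝓘(ℝ, E) x) :
    curvature D x a b c + curvature D x b c a + curvature D x c a b = 0 := by
  simp only [curvature]
  set X : ∀ y : M, TangentSpace 𝓘(ℝ, E) y := FiberBundle.extend E a
  set Y : ∀ y : M, TangentSpace 𝓘(ℝ, E) y := FiberBundle.extend E b
  set Z : ∀ y : M, TangentSpace 𝓘(ℝ, E) y := FiberBundle.extend E c
  set u : Set M := (trivializationAt E (TangentSpace 𝓘(ℝ, E)) x).baseSet
  have hu : IsOpen u := (trivializationAt E (TangentSpace 𝓘(ℝ, E)) x).open_baseSet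
  have hxu : x ∈ u := FiberBundle.mem_baseSet_trivializationAt' x
  have hX : CMDiff[u] ∞ (T% X) := contMDiffOn_extend_baseSet a
  have hY : CMDiff[u] ∞ (T% Y) := contMDiffOn_extend_baseSet b
  have hZ : CMDiff[u] ∞ (T% Z) := contMDiffOn_extend_baseSet c
  have at_ : ∀ {σ : ∀ y : M, TangentSpace 𝓘(ℝ, E) y}, CMDiff[u] ∞ (T% σ) →
      ∀ y ∈ u, MDiffAt (T% σ) y := fun {σ} h y hy =>
    (h.contMDiffAt (hu.mem_nhds hy)).mdifferentiableAt (by simp)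
  have tor : ∀ {P Q : ∀ y : M, TangentSpace 𝓘(ℝ, E) y} {y : M}, MDiffAt (T% P) y →
      MDiffAt (T% Q) y → D Q y (P y) - D P y (Q y) = mlieBracket 𝓘(ℝ, E) P Q y :=
    D.torsion_eq_zero_iff.1 ht
  -- Vanishing torsion turns `D_Q R - D_R Q` into `[Q, R]`, and then `D_P [Q, R] - D_{[Q, R]} P`
  -- into `[P, [Q, R]]`. The cyclic sum of curvatures regroups into three such terms, which cancel
  -- by Jacobi.
  have main : ∀ {P Q R : ∀ y : M, TangentSpace 𝓘(ℝ, E) y}, CMDiff[u] ∞ (T% P) →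
      CMDiff[u] ∞ (T% Q) → CMDiff[u] ∞ (T% R) →
      D (fun y => D R y (Q y)) x (P x) - D (fun y => D Q y (R y)) x (P x)
        - D P x (mlieBracket 𝓘(ℝ, E) Q R x) =
      mlieBracket 𝓘(ℝ, E) P (mlieBracket 𝓘(ℝ, E) Q R) x := by
    intro P Q R hP hQ hR
    have d1 := at_ (contMDiffOn_cov_apply hD hu hR hQ) x hxu
    have d2 := at_ (contMDiffOn_cov_apply hD hu hQ hR) x hxu
    have hbr : MDiffAt (T% (mlieBracket 𝓘(ℝ, E) Q R)) x :=
      mdifferentiableAt_mlieBracket (hQ.contMDiffAt (hu.mem_nhds hxu))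
        (hR.contMDiffAt (hu.mem_nhds hxu))
    have e1 : D (fun y => D R y (Q y)) x =
        D (mlieBracket 𝓘(ℝ, E) Q R) x + D (fun y => D Q y (R y)) x := by
      rw [← D.isCovariantDerivativeOn.add (s := Set.univ) hbr d2]
      refine D.isCovariantDerivativeOn.congr_of_eventuallyEq (s := Set.univ) d1
        (mdifferentiableAt_add_section hbr d2) Filter.univ_mem ?_
      filter_upwards [hu.mem_nhds hxu] with y hy
      rw [Pi.add_apply, ← tor (at_ hQ y hy) (at_ hR y hy), sub_add_cancel]
    rw [← tor (at_ hP x hxu) hbr, e1, add_apply]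
    abel
  have J := jacobi_mlieBracket (hX.contMDiffAt (hu.mem_nhds hxu)) (hY.contMDiffAt (hu.mem_nhds hxu))
    (hZ.contMDiffAt (hu.mem_nhds hxu))
  have m1 := main hX hY hZ
  have m2 := main hY hZ hX
  have m3 := main hZ hX hY
  rw [mlieBracket_swap_apply (V := mlieBracket 𝓘(ℝ, E) X Y),
    mlieBracket_swap (V := X) (W := Z)] at J
  have e0 : mlieBracket 𝓘(ℝ, E) Y (-mlieBracket 𝓘(ℝ, E) Z X) x =
      - mlieBracket 𝓘(ℝ, E) Y (mlieBracket 𝓘(ℝ, E) Z X) x := by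
    have hbr : MDiffAt (T% (mlieBracket 𝓘(ℝ, E) Z X)) x :=
      mdifferentiableAt_mlieBracket (hZ.contMDiffAt (hu.mem_nhds hxu))
        (hX.contMDiffAt (hu.mem_nhds hxu))
    have := mlieBracket_const_smul_right (I := 𝓘(ℝ, E)) (V := Y) (c := (-1 : ℝ)) hbr
    simpa using this
  rw [e0, ← m1, ← m2, ← m3] at J
  refine Eq.trans ?_ (sub_eq_zero.2 J)
  module

end Curvature

/-! ### From the identities to the inequalities -/

section Inequalities

variable {T : Type*} [NormedAddCommGroup T] [InnerProductSpace ℝ T]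
  {W : Type*} [NormedAddCommGroup W] [InnerProductSpace ℝ W]

lemma normSq_nonneg {n m : ℕ} (e : OrthonormalBasis (Fin n) ℝ T) (s : OrthonormalBasis (Fin m) ℝ W)
    (B : BiForms T W) : 0 ≤ normSq e s B :=
  Finset.sum_nonneg fun _ _ => sq_nonneg _

@[simp]
lemma normSq_zero {n m : ℕ} (e : OrthonormalBasis (Fin n) ℝ T)
    (s : OrthonormalBasis (Fin m) ℝ W) : normSq e s 0 = 0 := by
  simp [normSq]

lemma TopNonneg.topAbsLE {v α β : Forms T} (h₁ : TopNonneg v (β + α)) (h₂ : TopNonneg v (β - α)) :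
    TopAbsLE v α β := by
  obtain ⟨c, hc, h₁⟩ := h₁
  obtain ⟨d, hd, h₂⟩ := h₂
  refine ⟨(c - d) / 2, (c + d) / 2, ?_, ?_, abs_le.2 ⟨by linarith, by linarith⟩⟩
  · have : (2 : ℝ) • α = (c - d) • v := by
      rw [sub_smul, ← h₁, ← h₂]
      module
    rw [div_eq_inv_mul, mul_smul, ← this, smul_smul]
    norm_num
  · have : (2 : ℝ) • β = (c + d) • v := by
      rw [add_smul, ← h₁, ← h₂]
      module
    rw [div_eq_inv_mul, mul_smul, ← this, smul_smul]
    norm_num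

/-- The identities and inequalities for an operator that has the symmetries of the curvature of a
metric connection. -/
theorem thorpe_of_skew {k : ℕ} {R : T → T → W → W}
    {e : OrthonormalBasis (Fin (4 * k)) ℝ T} {s : OrthonormalBasis (Fin (4 * k)) ℝ W}
    (hR : ∀ i j a b, inner ℝ (R (e i) (e j) (s a)) (s b) = - inner ℝ (R (e i) (e j) (s b)) (s a)) :
    ((2 * k).choose k : ℝ) • eulerForm k R e s + pontryaginForm k R e s =
      (2 / ((2 * Real.pi) ^ (2 * k) * (k.factorial : ℝ) ^ 2) *
        (normSq e s (powComponent k R e s 1 1)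
          - normSq e s (powComponent k R e s (-1) 1))) • volumeElement e ∧
    ((2 * k).choose k : ℝ) • eulerForm k R e s - pontryaginForm k R e s =
      (2 / ((2 * Real.pi) ^ (2 * k) * (k.factorial : ℝ) ^ 2) *
        (normSq e s (powComponent k R e s (-1) (-1))
          - normSq e s (powComponent k R e s 1 (-1)))) • volumeElement e ∧
    (powComponent k R e s (-1) 1 = 0 → TopNonneg (volumeElement e)
      (((2 * k).choose k : ℝ) • eulerForm k R e s + pontryaginForm k R e s)) ∧
    (powComponent k R e s 1 (-1) = 0 → TopNonneg (volumeElement e)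
      (((2 * k).choose k : ℝ) • eulerForm k R e s - pontryaginForm k R e s)) ∧
    (powComponent k R e s (-1) 1 = 0 → powComponent k R e s 1 (-1) = 0 →
      TopAbsLE (volumeElement e) (pontryaginForm k R e s)
        (((2 * k).choose k : ℝ) • eulerForm k R e s)) := by
  have h₁ : ((2 * k).choose k : ℝ) • eulerForm k R e s + pontryaginForm k R e s =
      (2 / ((2 * Real.pi) ^ (2 * k) * (k.factorial : ℝ) ^ 2) *
        (normSq e s (powComponent k R e s 1 1)
          - normSq e s (powComponent k R e s (-1) 1))) • volumeElement e := by
    simpa using choose_smul_eulerForm_add_smul_pontryaginForm hR 1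
  have h₂ : ((2 * k).choose k : ℝ) • eulerForm k R e s - pontryaginForm k R e s =
      (2 / ((2 * Real.pi) ^ (2 * k) * (k.factorial : ℝ) ^ 2) *
        (normSq e s (powComponent k R e s (-1) (-1))
          - normSq e s (powComponent k R e s 1 (-1)))) • volumeElement e := by
    simpa [← sub_eq_add_neg] using choose_smul_eulerForm_add_smul_pontryaginForm hR (-1)
  have h₃ : powComponent k R e s (-1) 1 = 0 → TopNonneg (volumeElement e)
      (((2 * k).choose k : ℝ) • eulerForm k R e s + pontryaginForm k R e s) := fun h =>
    ⟨_, mul_nonneg (by positivity)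
      (by rw [h, normSq_zero, sub_zero]; exact normSq_nonneg _ _ _), h₁⟩
  have h₄ : powComponent k R e s 1 (-1) = 0 → TopNonneg (volumeElement e)
      (((2 * k).choose k : ℝ) • eulerForm k R e s - pontryaginForm k R e s) := fun h =>
    ⟨_, mul_nonneg (by positivity)
      (by rw [h, normSq_zero, sub_zero]; exact normSq_nonneg _ _ _), h₂⟩
  exact ⟨h₁, h₂, h₃, h₄, fun h h' => (h₃ h).topAbsLE (h₄ h')⟩

/-- Skew-symmetry and the first Bianchi identity imply the symmetry in pairs. -/
lemma inner_pairSymmetric {R : T → T → T → T}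
    (h₁ : ∀ a b c, R a b c = - R b a c)
    (h₂ : ∀ a b c d, inner ℝ (R a b c) d = - inner ℝ (R a b d) c)
    (h₃ : ∀ a b c, R a b c + R b c a + R c a b = 0) (a b c d : T) :
    inner ℝ (R a b c) d = inner ℝ (R d c b) a := by
  have s₁ : ∀ a b c d, inner ℝ (R a b c) d = - inner ℝ (R b a c) d := fun a b c d => by
    rw [h₁, inner_neg_left]
  have bi : ∀ a b c d, inner ℝ (R a b c) d + inner ℝ (R b c a) d + inner ℝ (R c a b) d = 0 :=
    fun a b c d => by rw [← inner_add_left, ← inner_add_left, h₃, inner_zero_left]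
  -- The classical octahedron argument: the claim is a linear combination of the Bianchi identities
  -- at the four cyclic rotations of `a, b, c, d`, modulo skewness in each pair.
  linarith [bi a b c d, bi b c d a, bi c d a b, bi d a b c, h₂ a b c d, h₂ b c a d, s₁ c a b d,
    h₂ a c b d, h₂ c d b a, s₁ d c b a, s₁ d b c a, h₂ b d c a, h₂ d a c b]

end Inequalities

end

end Thorpe

/-! ### The generalized Thorpe inequalities -/

theorem mainTheorem1
    {k : ℕ} (hk : 0 < k)
    -- a smooth oriented Riemannian manifold `M` of dimension `4 k`
    {E : Type*} [NormedAddCommGroup E] [NormedSpace ℝ E] [FiniteDimensional ℝ E]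
    (hE : Module.finrank ℝ E = 4 * k)
    {M : Type*} [TopologicalSpace M] [T2Space M] [ChartedSpace E M] [IsManifold 𝓘(ℝ, E) ∞ M]
    [RiemannianBundle (fun x : M => TangentSpace 𝓘(ℝ, E) x)]
    [IsContMDiffRiemannianBundle 𝓘(ℝ, E) ∞ E (fun x : M => TangentSpace 𝓘(ℝ, E) x)]
    (oM : BundleOrientation E (fun x : M => TangentSpace 𝓘(ℝ, E) x) (4 * k))
    -- a smooth vector bundle `V` over `M` of rank `4 k` with a smooth inner product
    {F : Type*} [NormedAddCommGroup F] [NormedSpace ℝ F] [FiniteDimensional ℝ F]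
    (hF : Module.finrank ℝ F = 4 * k)
    {V : M → Type*} [TopologicalSpace (TotalSpace F V)]
    [∀ x, NormedAddCommGroup (V x)] [∀ x, InnerProductSpace ℝ (V x)]
    [FiberBundle F V] [VectorBundle ℝ F V] [ContMDiffVectorBundle ∞ F V 𝓘(ℝ, E)]
    [IsContMDiffRiemannianBundle 𝓘(ℝ, E) ∞ F V] :
    -- for every orientation of `V` and every compatible smooth connection `D` on `V`, at every
    -- point `x` and in all oriented orthonormal bases `e` of the tangent space and `s` of the fiber
    (∀ (oV : BundleOrientation F V (4 * k)) (D : CovariantDerivative 𝓘(ℝ, E) F V),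
      D.ContMDiffCovariantDerivative ∞ → D.IsMetricCompatible →
      ∀ (x : M) (e : OrthonormalBasis (Fin (4 * k)) ℝ (TangentSpace 𝓘(ℝ, E) x))
        (s : OrthonormalBasis (Fin (4 * k)) ℝ (V x)),
        e.toBasis.orientation = oM.orientationAt x → s.toBasis.orientation = oV.orientationAt x →
        ((2 * k).choose k : ℝ) • eulerForm k (curvature D x) e s
            + pontryaginForm k (curvature D x) e s =
          (2 / ((2 * Real.pi) ^ (2 * k) * (k.factorial : ℝ) ^ 2) *
            (normSq e s (powComponent k (curvature D x) e s 1 1)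
              - normSq e s (powComponent k (curvature D x) e s (-1) 1))) • volumeElement e ∧
        ((2 * k).choose k : ℝ) • eulerForm k (curvature D x) e s
            - pontryaginForm k (curvature D x) e s =
          (2 / ((2 * Real.pi) ^ (2 * k) * (k.factorial : ℝ) ^ 2) *
            (normSq e s (powComponent k (curvature D x) e s (-1) (-1))
              - normSq e s (powComponent k (curvature D x) e s 1 (-1)))) • volumeElement e ∧
        (powComponent k (curvature D x) e s (-1) 1 = 0 →
          TopNonneg (volumeElement e)
            (((2 * k).choose k : ℝ) • eulerForm k (curvature D x) e s
              + pontryaginForm k (curvature D x) e s)) ∧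
        (powComponent k (curvature D x) e s 1 (-1) = 0 →
          TopNonneg (volumeElement e)
            (((2 * k).choose k : ℝ) • eulerForm k (curvature D x) e s
              - pontryaginForm k (curvature D x) e s)) ∧
        (powComponent k (curvature D x) e s (-1) 1 = 0 →
          powComponent k (curvature D x) e s 1 (-1) = 0 →
          TopAbsLE (volumeElement e) (pontryaginForm k (curvature D x) e s)
            (((2 * k).choose k : ℝ) • eulerForm k (curvature D x) e s))) ∧
    -- for the Levi-Civita connection `D` on the tangent bundle of `M`, at every point `x` and in
    -- all oriented orthonormal bases `e` of the tangent space
    (∀ D : CovariantDerivative 𝓘(ℝ, E) E (fun x : M => TangentSpace 𝓘(ℝ, E) x),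
      D.ContMDiffCovariantDerivative ∞ → D.IsMetricCompatible → D.torsion = 0 →
      ∀ (x : M) (e : OrthonormalBasis (Fin (4 * k)) ℝ (TangentSpace 𝓘(ℝ, E) x)),
        e.toBasis.orientation = oM.orientationAt x →
        (powComponent k (curvature D x) e e (-1) 1 = 0 ↔
          powComponent k (curvature D x) e e 1 (-1) = 0) ∧
        (powComponent k (curvature D x) e e (-1) 1 = 0 ∨
          powComponent k (curvature D x) e e 1 (-1) = 0 →
          TopAbsLE (volumeElement e) (pontryaginForm k (curvature D x) e e)
            (((2 * k).choose k : ℝ) • eulerForm k (curvature D x) e e))) := by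
  -- Positive dimension supplies the nonzero tangent vector behind `mvfderiv_mlieBracket`, hence
  -- behind skewness.
  have : Nontrivial E := Module.nontrivial_of_finrank_pos (R := ℝ) (by omega)
  refine ⟨fun _ D hD hm x e s _ _ => thorpe_of_skew fun i j a b =>
    inner_curvature_skew hD hm x (e i) (e j) (s a) (s b), fun D hD hm ht x e _ => ?_⟩
  have skew := inner_curvature_skew hD hm x
  have iff : powComponent k (curvature D x) e e (-1) 1 = 0 ↔
      powComponent k (curvature D x) e e 1 (-1) = 0 :=
    powComponent_eq_zero_iff_of_pairSymmetric (fun i j a b =>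
      inner_pairSymmetric (curvature_swap D x) skew (curvature_bianchi hD ht x) _ _ _ _) _ _
  have ineq := (thorpe_of_skew (k := k) (e := e) (s := e) (R := curvature D x)
    fun i j a b => skew (e i) (e j) (e a) (e b)).2.2.2.2
  exact ⟨iff, fun h => h.elim (fun h => ineq h (iff.1 h)) fun h => ineq (iff.2 h) h⟩
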